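/- Let $H_n$ denote the Hermite polynomials with $\sum_{n\ge 0} H_n(x)t^n/n! = e^{2xt-t^2}$, and let $(a)_k=a(a+1)\cdots(a+k-1)$. Let $N\ge 1$, let $\alpha_1=1,\alpha_2,\dots,\alpha_N$ be non-zero real numbers, and let $\nu\in\mathbb{R}$. For every $\mu\in\{\nu,\nu+1,\nu+2,\dots\}$ let $c^{(\mu)}>0$, $d^{(\mu)}>0$ and $\delta^{(\mu)}_1,\dots,\delta^{(\mu)}_N>0$ be real numbers such that $$\delta^{(\mu+1)}_k=(k\,d^{(\mu)}+c^{(\mu)})\,\delta^{(\mu)}_k\quad(1\le k\le N),\qquad \frac{\alpha_{k+1}^2}{\alpha_k^2}=\frac{d^{(\mu)}k(N-k)}{2(d^{(\mu)}k+c^{(\mu)})}\,\frac{\delta^{(\mu)}_{k+1}}{\delta^{(\mu)}_k}\quad(1\le k\le N-1).$$ Let $L(x)$ be the lower triangular $N\times N$ matrix with entries $L(x)_{m,n}=H_{m-n}(x)/(m-n)!$ for $m\ge n$ and $0$ for $m<n$; put $S^\alpha=\mathrm{diag}(\alpha_1,\dots,\alpha_N)$, $L^\alpha(x)=S^\alpha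 L(x)(S^\alpha)^{-1}$, and define the matrix weight $$W^{(\alpha,\nu)}(x)=e^{-x^2}\,L^\alpha(x)\,\mathrm{diag}(\delta^{(\nu)}_1,\dots,\delta^{(\nu)}_N)\,L^\alpha(x)^\ast,\qquad x\in\mathbb{R}.$$ Then there is a unique sequence $(P^{(\alpha,\nu)}_n)_{n\ge 0}$ of polynomials with coefficients in $\mathrm{Mat}_N(\mathbb{C})$ such that $P^{(\alpha,\nu)}_n$ is monic of degree $n$ and $\int_{\mathbb{R}}P^{(\alpha,\nu)}_m(x)W^{(\alpha,\nu)}(x)P^{(\alpha,\nu)}_n(x)^\ast\,dx=0$ for $m\ne n$, and for all $n\ge 0$, all $1\le r,t\le N$ and all $x\in\mathbb{C}$ $$\bigl(P^{(\alpha,\nu)}_n(x)\bigr)_{r,t}=\frac{\alpha_r}{2^n\alpha_t}\,\frac{1}{(r-1)!}\left(\prod_{k=0}^{n-1}\frac{1+\frac{c^{(\nu+k)}}{d^{(\nu+k)}}}{N-r+1+\frac{c^{(\nu+k)}}{d^{(\nu+k)}}}\right) \sum_{s=t}^{\min(N,n+r)}\frac{i^{s-t}(N-s+1)_{s-1}}{(s-t)!}\;F_{r,s}(n)\;H_{n+r-s}(x)\,H_{s-t}(ix),$$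 where $F_{r,s}(n)$ is the terminating hypergeometric series $$F_{r,s}(n)={}_3F_2\!\left(\begin{matrix}1-s,\ r-N,\ n+1+c^{(\nu)}/d^{(\nu)}\\ 1-N,\ 1+c^{(\nu)}/d^{(\nu)}\end{matrix};1\right) =\sum_{k=0}^{\min(s-1,\,N-r)}\frac{(1-s)_k\,(r-N)_k\,(n+1+c^{(\nu)}/d^{(\nu)})_k}{(1-N)_k\,(1+c^{(\nu)}/d^{(\nu)})_k\,k!}.$$ An empty sum is $0$ and an empty product is $1$. -/

import Mathlib

open scoped Matrix

noncomputable section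

namespace MVHermite

/-- The (physicists') Hermite polynomials `H₀ = 1`, `H₁ = 2x`, `H₂ = 4x² - 2`, …, i.e. those with
generating function `∑ H_n(x) tⁿ / n! = exp (2xt - t²)`. -/
def hermitePoly : ℕ → Polynomial ℂ
  | 0 => 1
  | n + 1 => 2 * Polynomial.X * hermitePoly n - Polynomial.derivative (hermitePoly n)

/-- The value `H_n(z)` of the Hermite polynomial at a complex number. -/
def H (n : ℕ) (z : ℂ) : ℂ := (hermitePoly n).eval z

/-- The shifted factorial `(a)_k = a (a+1) ⋯ (a+k-1)`. -/
def poch (a : ℂ) (k : ℕ) : ℂ := (ascPochhammer ℂ k).eval a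

/-- The hypergeometric series `₃F₂(a, b, c; d, e; z)`. If a numerator parameter is `-m` with
`m : ℕ`, all terms with `k > m` vanish, so that the series is the usual terminating sum. -/
def threeFTwo (a b c d e z : ℂ) : ℂ :=
  ∑' k : ℕ, poch a k * poch b k * poch c k / (poch d k * poch e k * (k.factorial : ℂ)) * z ^ k

/-- The lower triangular Toeplitz matrix `L(x)`. -/
def L (N : ℕ) (x : ℂ) : Matrix (Fin N) (Fin N) ℂ :=
  Matrix.of fun m n =>
    if n ≤ m then H ((m : ℕ) - (n : ℕ)) x / (((m : ℕ) - (n : ℕ)).factorial : ℂ) else 0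

/-- `S^α = diag(α₁, …, α_N)`; row and column `i : Fin N` carry the label `i + 1`. -/
def S (N : ℕ) (α : ℕ → ℝ) : Matrix (Fin N) (Fin N) ℂ :=
  Matrix.diagonal fun i => (α ((i : ℕ) + 1) : ℂ)

/-- `L^α(x) = S^α L(x) (S^α)⁻¹`. -/
def Lα (N : ℕ) (α : ℕ → ℝ) (x : ℂ) : Matrix (Fin N) (Fin N) ℂ :=
  S N α * L N x * (S N α)⁻¹

/-- `T(x) = exp(-x²) diag(δ₁, …, δ_N)`. -/
def T (N : ℕ) (δ : ℕ → ℝ) (x : ℝ) : Matrix (Fin N) (Fin N) ℂ :=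
  (Real.exp (-x ^ 2) : ℂ) • Matrix.diagonal fun i : Fin N => (δ ((i : ℕ) + 1) : ℂ)

/-- The matrix weight `W(x) = L^α(x) T(x) L^α(x)*` on the real line. -/
def weight (N : ℕ) (α δ : ℕ → ℝ) (x : ℝ) : Matrix (Fin N) (Fin N) ℂ :=
  Lα N α (x : ℂ) * T N δ x * (Lα N α (x : ℂ))ᴴ

/-- The value `P(x)` of a polynomial with matrix coefficients at a scalar `x`. -/
def evalAt {N : ℕ} (P : Polynomial (Matrix (Fin N) (Fin N) ℂ)) (x : ℂ) :
    Matrix (Fin N) (Fin N) ℂ :=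
  P.eval (Matrix.scalar (Fin N) x)

/-- The matrix valued inner product `⟨P, Q⟩ = ∫_ℝ P(x) W(x) Q(x)* dx`, integrated entrywise. -/
def innerW {N : ℕ} (W : ℝ → Matrix (Fin N) (Fin N) ℂ)
    (P Q : Polynomial (Matrix (Fin N) (Fin N) ℂ)) : Matrix (Fin N) (Fin N) ℂ :=
  Matrix.of fun i j => ∫ x : ℝ, (evalAt P (x : ℂ) * W x * (evalAt Q (x : ℂ))ᴴ) i j

/-- `P` is a sequence of monic matrix valued orthogonal polynomials for the weight `W`:
`P n` is monic of degree `n`, and distinct members are orthogonal. -/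
def IsMonicOPS {N : ℕ} (W : ℝ → Matrix (Fin N) (Fin N) ℂ)
    (P : ℕ → Polynomial (Matrix (Fin N) (Fin N) ℂ)) : Prop :=
  (∀ n, (P n).Monic ∧ (P n).natDegree = n) ∧
    ∀ m n, m ≠ n → innerW W (P m) (P n) = 0

end MVHermite

end

/-! Put q = c/d at the parameter ν and count rows and columns from 0. The candidate P_n is found by
prescribing P_n L^α: up to the factor α_i/α_a, its (i, a) entry is `mvCoeff` times H_{n+i-a}, where
`mvCoeff` is, up to elementary factors, a Hahn function of a. Multiplying by the inverse of L^α,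
whose entries are the H_k(ix) i^k/k!, gives the stated sum. It remains to see that this P_n is
orthogonal, is monic of degree n, and is the only choice.

Orthogonality. Absorbing L^α into the polynomials leaves the diagonal weight exp(-x²) diag(δ). The
(i, j) entry of ⟨P_m, P_n⟩ is then a sum over a of integrals of H_{m+i-a} H_{n+j-a}, which vanish
unless m + i = n + j = K. In that case the Hermite norms and the closed form of δ
(`weight_coefficients`) combine to `hahnWeight`. For fixed K the Hahn functions are eigenfunctions
of one second order difference operator with distinct eigenvalues, so they are orthogonal for that
weight (`hahn_orthogonality`).

Degree. A priori column b of row i has degree up to n + i - b. The entries of a row satisfy Hermite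
type differential equations, each coupled to the next column (`rowPoly_ode`). Comparing top
coefficients, from the last column down, leaves n + i - b as the only possible degree above n. The
coefficient there is an iterated difference of the Hahn function; it is zero for b < i and yields 1
for b = i (`sum_mvCoeff`, `natDegree_rowPoly_le`).

Uniqueness is positive definiteness of the inner product. The product in the formula becomes a ratio
of shifted factorials because, for N ≥ 2, the recursions force c/d to grow by 1 at each step
(`ratio_succ`). -/

open scoped Matrix

noncomputable section

namespace MVHermite

/-! ### Hahn functions: vanishing, difference equation, orthogonality. -/

/-- The coefficient `(i+1-N)_k (n+1+q)_k / ((1-N)_k (1+q)_k)` of the dual Hahn expansion. -/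
def hahnCoeff (N : ℕ) (q : ℝ) (n i k : ℕ) : ℝ :=
  (ascPochhammer ℝ k).eval ((i : ℝ) + 1 - N) * (ascPochhammer ℝ k).eval ((n : ℝ) + 1 + q) /
    ((ascPochhammer ℝ k).eval (1 - (N : ℝ)) * (ascPochhammer ℝ k).eval (1 + q))

/-- The Hahn function `a ↦ ₃F₂(-a, i+1-N, n+1+q; 1-N, 1+q; 1)`. -/
def hahn (N : ℕ) (q : ℝ) (n i a : ℕ) : ℝ :=
  ∑ k ∈ Finset.range N, (-1) ^ k * (a.choose k : ℝ) * hahnCoeff N q n i k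

theorem ascPochhammer_eval_ne_zero_of_pos {q : ℝ} (hq : 0 < q) (k : ℕ) :
    (ascPochhammer ℝ k).eval (1 + q) ≠ 0 :=
  (ascPochhammer_pos k _ (by linarith)).ne'

theorem ascPochhammer_eval_neg_natCast (m k : ℕ) :
    (ascPochhammer ℝ k).eval (-(m : ℝ)) = (-1) ^ k * (m.descFactorial k : ℝ) := by
  rw [ascPochhammer_eval_neg_eq_descPochhammer, descPochhammer_eval_eq_descFactorial]

theorem hahnCoeff_eq_zero {N : ℕ} {q : ℝ} {n i k : ℕ} (hi : i < N) (hk : N ≤ k + i) :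
    hahnCoeff N q n i k = 0 := by
  have h : (i : ℝ) + 1 - N = -((N - 1 - i : ℕ) : ℝ) := by
    rw [Nat.sub_sub, Nat.cast_sub (by omega)]; push_cast; ring
  rw [hahnCoeff, h, ascPochhammer_eval_neg_natCast,
    Nat.descFactorial_of_lt (by omega : N - 1 - i < k)]
  simp

theorem hahnCoeff_succ {N : ℕ} {q : ℝ} (hq : 0 < q) {n i : ℕ} (hi : i < N) (k : ℕ) :
    ((k : ℝ) + 1 - N) * (k + 1 + q) * hahnCoeff N q n i (k + 1) =
      (k + i + 1 - N) * (k + n + 1 + q) * hahnCoeff N q n i k := by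
  rcases lt_or_ge (k + 1) N with hk | hk
  · have h1 : ((k : ℝ) + 1 - N) ≠ 0 := by
      have : ((k + 1 : ℕ) : ℝ) < N := by exact_mod_cast hk
      push_cast at this; linarith
    have h2 : (k : ℝ) + 1 + q ≠ 0 := by positivity
    have h3 := ascPochhammer_eval_ne_zero_of_pos hq k
    have h4 : (ascPochhammer ℝ k).eval (1 - (N : ℝ)) ≠ 0 := by
      have h : 1 - (N : ℝ) = -((N - 1 : ℕ) : ℝ) := by
        rw [Nat.cast_sub (by omega)]; push_cast; ring
      rw [h, ascPochhammer_eval_neg_natCast]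
      have h0 : ((N - 1).descFactorial k : ℝ) ≠ 0 := by
        have : (N - 1).descFactorial k ≠ 0 := by
          rw [Ne, Nat.descFactorial_eq_zero_iff_lt]; omega
        exact_mod_cast this
      exact mul_ne_zero (by simp) h0
    have h5 : 1 - (N : ℝ) + k ≠ 0 := by rw [show 1 - (N : ℝ) + k = k + 1 - N by ring]; exact h1
    have h6 : 1 + q + k ≠ 0 := by rw [show 1 + q + k = k + 1 + q by ring]; exact h2
    simp only [hahnCoeff, ascPochhammer_succ_eval]
    field_simp
    ring
  -- Here the denominator may contain (1-N)_k = 0, so the ratio argument is unavailable. Instead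
  -- both sides vanish: the right one through the factor k + i + 1 - N when i = 0 and k + 1 = N, and
  -- otherwise through the coefficient.
  · rw [hahnCoeff_eq_zero hi (by omega : N ≤ k + 1 + i)]
    rcases Nat.eq_zero_or_pos i with rfl | h0
    · rcases Nat.eq_or_lt_of_le hk with h | h
      · rw [h]; push_cast; ring
      · rw [hahnCoeff_eq_zero hi (by omega)]; ring
    · rw [hahnCoeff_eq_zero hi (by omega)]; ring

/-- Vanishing of alternating binomial sums of polynomials of low degree. -/
theorem sum_neg_one_pow_choose_mul_eval_eq_zero {p : Polynomial ℝ} {m : ℕ} (h : p.natDegree < m) :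
    ∑ k ∈ Finset.range (m + 1), (-1) ^ k * (m.choose k : ℝ) * p.eval (k : ℝ) = 0 := by
  have := congrFun (Polynomial.fwdDiff_iter_eq_zero_of_degree_lt h) (0 : ℝ)
  rw [fwdDiff_iter_eq_sum_shift] at this
  have h2 := congrArg (fun x => (-1 : ℝ) ^ m * x) this
  simp only [Finset.mul_sum, Pi.zero_apply, mul_zero] at h2
  rw [← h2]
  refine Finset.sum_congr rfl fun k hk => ?_
  have hk : k ≤ m := by simpa [Nat.lt_succ_iff] using hk
  obtain ⟨l, rfl⟩ := Nat.exists_eq_add_of_le hk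
  simp only [Nat.add_sub_cancel_left, zsmul_eq_mul]
  push_cast
  have : (-1 : ℝ) ^ (k + l) * (-1) ^ l = (-1) ^ k := by
    rw [pow_add, mul_assoc, ← mul_pow]; simp
  simp only [zero_add, nsmul_eq_mul, mul_one]
  rw [← this]; ring

/-- Both Pochhammer ratios in k can be flipped: (i+1-N)_k/(1-N)_k is a polynomial in k of degree i
on 0 ≤ k < N, and (n+1+q)_k/(1+q)_k is one of degree n. The total degree n + i is what makes the
Hahn function vanish beyond n + i. -/
theorem hahnCoeff_eq_eval {N : ℕ} {q : ℝ} (hq : 0 < q) {n i k : ℕ} (hi : i < N) (hk : k < N) :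
    hahnCoeff N q n i k =
      (((Polynomial.C (((N - 1).descFactorial i : ℝ)⁻¹ *
            ((ascPochhammer ℝ n).eval (1 + q))⁻¹)) *
          (descPochhammer ℝ i).comp (Polynomial.C ((N : ℝ) - 1) - Polynomial.X)) *
        (ascPochhammer ℝ n).comp (Polynomial.X + Polynomial.C (1 + q))).eval (k : ℝ) := by
  have e1 : (i : ℝ) + 1 - N = -((N - 1 - i : ℕ) : ℝ) := by
    rw [Nat.sub_sub, Nat.cast_sub (by omega)]; push_cast; ring
  have e2 : 1 - (N : ℝ) = -((N - 1 : ℕ) : ℝ) := by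
    rw [Nat.cast_sub (by omega)]; push_cast; ring
  have e3 : (N : ℝ) - 1 - k = ((N - 1 - k : ℕ) : ℝ) := by
    rw [Nat.sub_sub, Nat.cast_sub (by omega)]; push_cast; ring
  have h1 : (((N - 1).descFactorial i * (N - 1 - i).descFactorial k : ℕ) : ℝ) =
      (((N - 1).descFactorial k * (N - 1 - k).descFactorial i : ℕ) : ℝ) := by
    congr 1
    rw [mul_comm, mul_comm ((N - 1).descFactorial k)]
    have a := Nat.descFactorial_mul_descFactorial (n := N - 1) (k := i) (m := i + k) (by omega)
    have b := Nat.descFactorial_mul_descFactorial (n := N - 1) (k := k) (m := i + k) (by omega)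
    simp only [Nat.add_sub_cancel_left, Nat.add_sub_cancel] at a b
    rw [a, b]
  have h2 : (ascPochhammer ℝ k).eval ((n : ℝ) + 1 + q) * (ascPochhammer ℝ n).eval (1 + q) =
      (ascPochhammer ℝ n).eval ((k : ℝ) + (1 + q)) * (ascPochhammer ℝ k).eval (1 + q) := by
    have a := congrArg (Polynomial.eval (1 + q)) (ascPochhammer_mul ℝ n k)
    have b := congrArg (Polynomial.eval (1 + q)) (ascPochhammer_mul ℝ k n)
    simp only [Polynomial.eval_mul, Polynomial.eval_comp, Polynomial.eval_add, Polynomial.eval_X,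
      Polynomial.eval_natCast] at a b
    rw [add_comm n k, ← b] at a
    rw [show (n : ℝ) + 1 + q = 1 + q + n by ring, show (k : ℝ) + (1 + q) = 1 + q + k by ring]
    linarith
  have n1 := ascPochhammer_eval_ne_zero_of_pos hq k
  have n2 := ascPochhammer_eval_ne_zero_of_pos hq n
  have n3 : ((N - 1).descFactorial k : ℝ) ≠ 0 := by
    have : (N - 1).descFactorial k ≠ 0 := by
      rw [Ne, Nat.descFactorial_eq_zero_iff_lt]; omega
    exact_mod_cast this
  have n4 : ((N - 1).descFactorial i : ℝ) ≠ 0 := by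
    have : (N - 1).descFactorial i ≠ 0 := by
      rw [Ne, Nat.descFactorial_eq_zero_iff_lt]; omega
    exact_mod_cast this
  simp only [hahnCoeff, Polynomial.eval_mul, Polynomial.eval_comp, Polynomial.eval_add,
    Polynomial.eval_sub, Polynomial.eval_X, Polynomial.eval_C]
  rw [e1, e2, e3, ascPochhammer_eval_neg_natCast, ascPochhammer_eval_neg_natCast,
    descPochhammer_eval_eq_descFactorial]
  push_cast at h1
  have n5 : (-1 : ℝ) ^ k ≠ 0 := by simp
  generalize (ascPochhammer ℝ k).eval ((n : ℝ) + 1 + q) = A at *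
  generalize (ascPochhammer ℝ n).eval ((k : ℝ) + (1 + q)) = B at *
  field_simp
  linear_combination A * (ascPochhammer ℝ n).eval (1 + q) * h1 +
    ((N - 1).descFactorial k : ℝ) * ((N - 1 - k).descFactorial i : ℝ) * h2

/-- The Hahn function vanishes beyond `n + i`. -/
theorem hahn_eq_zero {N : ℕ} {q : ℝ} (hq : 0 < q) {n i a : ℕ} (hi : i < N) (ha : a < N)
    (h : n + i < a) : hahn N q n i a = 0 := by
  have hs : hahn N q n i a =
      ∑ k ∈ Finset.range (a + 1), (-1) ^ k * (a.choose k : ℝ) * hahnCoeff N q n i k := by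
    symm
    refine Finset.sum_subset (Finset.range_mono ha) fun k _ hk => ?_
    rw [Nat.choose_eq_zero_of_lt (by simpa using hk)]; simp
  rw [hs]
  rw [Finset.sum_congr rfl fun k hk => by
    rw [hahnCoeff_eq_eval hq hi (by have := Finset.mem_range.1 hk; omega)]]
  -- The sum is now, up to sign, the a-th finite difference at 0 of a polynomial of degree at most n
  -- + i < a.
  refine sum_neg_one_pow_choose_mul_eval_eq_zero (lt_of_le_of_lt ?_ h)
  refine Polynomial.natDegree_mul_le.trans ?_
  rw [Polynomial.natDegree_comp, ascPochhammer_natDegree, Polynomial.natDegree_X_add_C, mul_one,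
    add_comm n]
  gcongr
  refine (Polynomial.natDegree_C_mul_le _ _).trans ?_
  rw [Polynomial.natDegree_comp]
  refine (Nat.mul_le_mul_left _ (Polynomial.natDegree_sub_le _ _)).trans ?_
  rw [Polynomial.natDegree_C, Polynomial.natDegree_X, descPochhammer_natDegree]
  simp

theorem natCast_mul_choose (a k : ℕ) :
    (a : ℝ) * a.choose k = k * a.choose k + (k + 1) * a.choose (k + 1) := by
  have : a * a.choose k = k * a.choose k + (k + 1) * a.choose (k + 1) := by
    rcases le_or_gt k a with h | h
    · have := Nat.choose_succ_right_eq a k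
      obtain ⟨l, rfl⟩ := Nat.exists_eq_add_of_le h
      simp only [Nat.add_sub_cancel_left] at this
      rw [mul_comm (k + 1), this]; ring
    · rw [Nat.choose_eq_zero_of_lt h, Nat.choose_eq_zero_of_lt (by omega)]; simp
  exact_mod_cast this

/-- `∑ (-1)^k k (a choose k) g_k`, which is `a (F(a) - F(a-1))` for the Hahn function `F`. -/
def hahnDiff (N : ℕ) (q : ℝ) (n i a : ℕ) : ℝ :=
  ∑ k ∈ Finset.range N, (-1) ^ k * k * (a.choose k : ℝ) * hahnCoeff N q n i k

theorem hahnDiff_zero (N : ℕ) (q : ℝ) (n i : ℕ) : hahnDiff N q n i 0 = 0 := by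
  refine Finset.sum_eq_zero fun k _ => ?_
  cases k <;> simp

theorem hahnDiff_succ (N : ℕ) (q : ℝ) (n i a : ℕ) :
    hahnDiff N q n i (a + 1) = (a + 1) * (hahn N q n i (a + 1) - hahn N q n i a) := by
  rw [hahnDiff, hahn, hahn, ← Finset.sum_sub_distrib, Finset.mul_sum]
  refine Finset.sum_congr rfl fun k _ => ?_
  have : (k : ℝ) * (a + 1).choose k = (a + 1) * ((a + 1).choose k - a.choose k) := by
    cases k with
    | zero => simp
    | succ k =>
      have h1 : (((a + 1) * a.choose k : ℕ) : ℝ) = (((a + 1).choose (k + 1) * (k + 1) : ℕ) : ℝ) := by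
        rw [Nat.add_one_mul_choose_eq]
      have h2 : (((a + 1).choose (k + 1) : ℕ) : ℝ) = ((a.choose k + a.choose (k + 1) : ℕ) : ℝ) := by
        rw [Nat.choose_succ_succ']
      push_cast at h1 h2 ⊢
      linear_combination -h1 - (a + 1) * h2
  linear_combination (-1) ^ k * hahnCoeff N q n i k * this

theorem hahn_succ_sub {N : ℕ} (q : ℝ) (n : ℕ) {i : ℕ} (hi : i < N) (a : ℕ) :
    hahn N q n i (a + 1) - hahn N q n i a =
      ∑ k ∈ Finset.range N, (-1) ^ (k + 1) * (a.choose k : ℝ) * hahnCoeff N q n i (k + 1) := by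
  obtain ⟨m, rfl⟩ : ∃ m, N = m + 1 := ⟨N - 1, by omega⟩
  rw [Finset.sum_range_succ, hahnCoeff_eq_zero hi (by omega), mul_zero, add_zero, hahn, hahn,
    ← Finset.sum_sub_distrib, Finset.sum_range_succ']
  simp only [Nat.choose_zero_right, sub_self, add_zero]
  refine Finset.sum_congr rfl fun k _ => ?_
  rw [Nat.choose_succ_succ']
  push_cast; ring

/-- The second order difference equation of the Hahn functions. -/
theorem hahn_difference_equation {N : ℕ} {q : ℝ} (hq : 0 < q) (n : ℕ) {i : ℕ} (hi : i < N)
    (a : ℕ) :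
    ((N : ℝ) - 1 - i) * (n + q + 1) * hahn N q n i a =
      (a + q + 1) * (a - N + 1) * (hahn N q n i (a + 1) - hahn N q n i a) -
        (a - (n + i) - 1) * hahnDiff N q n i a := by
  -- Telescoping certificate. Up to sign, the k-th summand of the difference of the two sides is
  -- v(k+1) - v(k), once a·(a choose k) and the coefficient of index k are eliminated by the two
  -- recursions. The factor k kills v at 0, and the vanishing coefficient kills it at N.
  let v : ℕ → ℝ := fun k =>
    (-1) ^ k * k * a.choose k * hahnCoeff N q n i k * (a + k + q + 1 - N)
  have tele : ∑ k ∈ Finset.range N, (v (k + 1) - v k) = 0 := by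
    rw [Finset.sum_range_sub]
    simp [v, hahnCoeff_eq_zero hi (Nat.le_add_right N i)]
  rw [← sub_eq_zero, hahn_succ_sub q n hi, hahn, hahnDiff, Finset.mul_sum, Finset.mul_sum,
    Finset.mul_sum, ← Finset.sum_sub_distrib, ← Finset.sum_sub_distrib, ← neg_eq_zero, ← tele,
    ← Finset.sum_neg_distrib]
  refine Finset.sum_congr rfl fun k _ => ?_
  have h1 := hahnCoeff_succ hq (n := n) hi k
  have h2 := natCast_mul_choose a k
  simp only [v]
  push_cast
  rw [pow_succ]
  linear_combination (-(-1) ^ k * (a.choose k : ℝ)) * h1 +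
    (-(-1) ^ k * (a + k + q + 2 - N) * hahnCoeff N q n i (k + 1)) * h2

/-- The weight of the Hahn functions with `n + i = K`. -/
def hahnWeight (N : ℕ) (q : ℝ) (K a : ℕ) : ℝ :=
  (ascPochhammer ℝ a).eval (1 + q) * ((K - a).factorial : ℝ) /
    ((a.factorial : ℝ) * ((N - 1 - a).factorial : ℝ))

/-- The Pearson relation, which makes the difference operator symmetric for this weight. -/
theorem hahnWeight_succ {N K a : ℕ} (q : ℝ) (hN : a + 1 < N) (hK : a + 1 ≤ K) :
    hahnWeight N q K (a + 1) * ((a + 1) * (a - K)) =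
      hahnWeight N q K a * ((a + q + 1) * (a - N + 1)) := by
  obtain ⟨u, rfl⟩ := Nat.exists_eq_add_of_le hK
  obtain ⟨v, rfl⟩ := Nat.exists_eq_add_of_lt hN
  have e1 : a + 1 + u - (a + 1) = u := by omega
  have e2 : a + 1 + u - a = u + 1 := by omega
  have e3 : a + 1 + v + 1 - 1 - (a + 1) = v := by omega
  have e4 : a + 1 + v + 1 - 1 - a = v + 1 := by omega
  simp only [hahnWeight, e1, e2, e3, e4, ascPochhammer_succ_eval, Nat.factorial_succ]
  push_cast
  have := Nat.factorial_ne_zero a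
  have := Nat.factorial_ne_zero v
  field_simp
  ring

/-- Summation by parts: cross-multiplying the two eigenvalue equations leaves a discrete Wronskian,
and by `hahnWeight_succ` the contributions of consecutive points cancel, so only the boundary term
at A survives. -/
theorem hahn_wronskian {N : ℕ} {q : ℝ} (hq : 0 < q) {n m i j K : ℕ} (hi : i < N) (hj : j < N)
    (hni : n + i = K) (hmj : m + j = K) (A : ℕ) (hA : A < N) (hAK : A ≤ K) :
    (((N : ℝ) - 1 - i) * (n + q + 1) - ((N : ℝ) - 1 - j) * (m + q + 1)) *
        ∑ a ∈ Finset.range (A + 1), hahnWeight N q K a * hahn N q n i a * hahn N q m j a =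
      hahnWeight N q K A * ((A + q + 1) * (A - N + 1)) *
        (hahn N q n i (A + 1) * hahn N q m j A - hahn N q n i A * hahn N q m j (A + 1)) := by
  have hni' : (n : ℝ) + i = K := by exact_mod_cast hni
  have hmj' : (m : ℝ) + j = K := by exact_mod_cast hmj
  induction A with
  | zero =>
    have h1 := hahn_difference_equation hq n hi 0
    have h2 := hahn_difference_equation hq m hj 0
    rw [hahnDiff_zero] at h1 h2
    rw [zero_add, Finset.sum_range_one]
    linear_combination hahnWeight N q K 0 * (hahn N q m j 0 * h1 - hahn N q n i 0 * h2)
  | succ A ih =>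
    rw [Finset.sum_range_succ, mul_add, ih (by omega) (by omega)]
    have h1 := hahn_difference_equation hq n hi (A + 1)
    have h2 := hahn_difference_equation hq m hj (A + 1)
    have h3 := hahnWeight_succ q hA hAK
    rw [hahnDiff_succ, hni'] at h1
    rw [hahnDiff_succ, hmj'] at h2
    push_cast at h1 h2 h3 ⊢
    linear_combination hahnWeight N q K (A + 1) *
        (hahn N q m j (A + 1) * h1 - hahn N q n i (A + 1) * h2) -
      (hahn N q n i (A + 1) * hahn N q m j A - hahn N q n i A * hahn N q m j (A + 1)) * h3

/-- Orthogonality of the Hahn functions. -/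
theorem hahn_orthogonality {N : ℕ} {q : ℝ} (hq : 0 < q) {n m i j K : ℕ} (hi : i < N) (hj : j < N)
    (hni : n + i = K) (hmj : m + j = K) (hij : i ≠ j) :
    ∑ a ∈ Finset.range N, hahnWeight N q K a * hahn N q n i a * hahn N q m j a = 0 := by
  have hl : ((N : ℝ) - 1 - i) * (n + q + 1) - ((N : ℝ) - 1 - j) * (m + q + 1) ≠ 0 := by
    have hni' : (n : ℝ) = K - i := by rw [← hni]; push_cast; ring
    have hmj' : (m : ℝ) = K - j := by rw [← hmj]; push_cast; ring
    have h1 : (i : ℝ) + 1 ≤ N := by exact_mod_cast hi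
    have h2 : (j : ℝ) ≤ K := by exact_mod_cast (by omega : j ≤ K)
    rw [hni', hmj']
    have : ((N : ℝ) - 1 - i) * (K - i + q + 1) - ((N : ℝ) - 1 - j) * (K - j + q + 1) =
        (j - i) * ((N - (i + 1)) + (K - j) + q + 1) := by ring
    rw [this]
    refine mul_ne_zero (sub_ne_zero.2 ?_) (by linarith)
    exact_mod_cast hij.symm
  refine (mul_eq_zero.1 ?_).resolve_left hl
  -- The boundary term vanishes for one of two reasons: if K < N - 1, both functions are zero at K +
  -- 1; otherwise the sum runs up to N - 1, where the factor A - N + 1 is zero.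
  rcases lt_or_ge K (N - 1) with h | h
  · have hs := Finset.sum_subset (s₁ := Finset.range (K + 1)) (s₂ := Finset.range N)
      (f := fun a => hahnWeight N q K a * hahn N q n i a * hahn N q m j a)
      (Finset.range_mono (by omega)) (fun a ha hK => by
        rw [hahn_eq_zero hq hi (Finset.mem_range.1 ha) (by
          rw [hni]; simp only [Finset.mem_range] at hK; omega)]
        ring)
    rw [← hs, hahn_wronskian hq hi hj hni hmj K (by omega) le_rfl,
      hahn_eq_zero (n := n) (a := K + 1) hq hi (by omega) (by omega),
      hahn_eq_zero (n := m) (a := K + 1) hq hj (by omega) (by omega)]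
    ring
  · obtain ⟨A, rfl⟩ : ∃ A, N = A + 1 := ⟨N - 1, by omega⟩
    rw [hahn_wronskian hq hi hj hni hmj A (by omega) (by omega)]
    push_cast
    ring

/-! ### Iterated differences of Hahn functions. -/

theorem sum_neg_one_pow_choose_mul_choose {m k : ℕ} (hk : k ≤ m) (b : ℕ) :
    ∑ l ∈ Finset.range (m + 1), (-1 : ℝ) ^ l * m.choose l * ((b + l).choose k : ℝ) =
      if k = m then (-1) ^ m else 0 := by
  obtain ⟨e, rfl⟩ := Nat.exists_eq_add_of_le' hk
  have h : (fwdDiff 1)^[e + k] (fun x ↦ (x.choose k : ℤ) : ℕ → ℤ) b = if e = 0 then 1 else 0 := by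
    rw [Function.iterate_add_apply]
    have := fwdDiff_iter_choose 0 k
    simp only [add_zero, Nat.choose_zero_right, Nat.cast_one] at this
    rw [this]
    cases e with
    | zero => simp
    | succ e =>
      rw [Function.iterate_succ_apply, fwdDiff_const, fwdDiff_iter_eq_sum_shift]
      simp
  rw [fwdDiff_iter_eq_sum_shift] at h
  have h2 := congrArg (fun z : ℤ => (-1 : ℝ) ^ (e + k) * (z : ℝ)) h
  simp only [Int.cast_sum, Finset.mul_sum] at h2
  calc _ = _ := Finset.sum_congr rfl fun l hl => ?_
    _ = _ := h2
    _ = _ := by by_cases he : e = 0 <;> simp [he]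
  obtain ⟨u, hu⟩ := Nat.exists_eq_add_of_le (Nat.lt_succ_iff.1 (Finset.mem_range.1 hl))
  have : (-1 : ℝ) ^ (l + u) * (-1) ^ u = (-1) ^ l := by
    rw [pow_add, mul_assoc, ← mul_pow]; simp
  simp only [hu, Nat.add_sub_cancel_left, smul_eq_mul, mul_one]
  push_cast
  rw [← this]; ring

/-- The difference of order N - 1 - b extracts the expansion coefficient of index N - 1 - b, which
vanishes for b < i. These sums turn up as the top coefficients of the entries of P_n. -/
theorem sum_neg_one_pow_choose_mul_hahn {N : ℕ} (q : ℝ) (n : ℕ) {i b : ℕ} (hi : i < N)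
    (hb : b ≤ i) :
    ∑ l ∈ Finset.range (N - b), (-1 : ℝ) ^ l * (N - 1 - b).choose l * hahn N q n i (b + l) =
      if b = i then hahnCoeff N q n i (N - 1 - i) else 0 := by
  obtain ⟨m, hm⟩ : ∃ m, N = b + m + 1 := ⟨N - 1 - b, by omega⟩
  rw [show N - b = m + 1 by omega, show N - 1 - b = m by omega]
  simp only [hahn, Finset.mul_sum]
  rw [Finset.sum_comm]
  have key : ∀ k ∈ Finset.range N, ∑ l ∈ Finset.range (m + 1), (-1 : ℝ) ^ l * m.choose l *
      ((-1) ^ k * ((b + l).choose k : ℝ) * hahnCoeff N q n i k) =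
      if k = m then hahnCoeff N q n i m else 0 := by
    intro k hk
    rcases le_or_gt k m with h | h
    · have := congrArg (fun z => (-1) ^ k * hahnCoeff N q n i k * z)
        (sum_neg_one_pow_choose_mul_choose h b)
      simp only [Finset.mul_sum] at this
      refine (Finset.sum_congr rfl fun l _ => by ring).trans (this.trans ?_)
      split_ifs with hkm
      · subst hkm
        rw [mul_right_comm, ← mul_pow]; simp
      · simp
    · rw [hahnCoeff_eq_zero hi (by omega), if_neg (by omega)]
      simp
  rw [Finset.sum_congr rfl key, Finset.sum_ite_eq', if_pos (by simp; omega)]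
  split_ifs with h
  · rw [show N - 1 - i = m by omega]
  · exact hahnCoeff_eq_zero hi (by omega)

/-- The value of the last coefficient of the Hahn expansion. -/
theorem hahnCoeff_last {N : ℕ} {q : ℝ} (hq : 0 < q) (n : ℕ) {i : ℕ} (hi : i < N) :
    hahnCoeff N q n i (N - 1 - i) * (ascPochhammer ℝ n).eval (1 + q) *
        ((N - 1).factorial : ℝ) =
      (ascPochhammer ℝ n).eval ((N : ℝ) - i + q) * (i.factorial : ℝ) *
        ((N - 1 - i).factorial : ℝ) := by
  rw [hahnCoeff_eq_eval hq hi (by omega)]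
  have e : (N : ℝ) - 1 - ((N - 1 - i : ℕ) : ℝ) = i := by
    rw [Nat.sub_sub, Nat.cast_sub (by omega)]; push_cast; ring
  have e' : ((N - 1 - i : ℕ) : ℝ) + (1 + q) = N - i + q := by
    rw [Nat.sub_sub, Nat.cast_sub (by omega)]; push_cast; ring
  simp only [Polynomial.eval_mul, Polynomial.eval_comp, Polynomial.eval_add,
    Polynomial.eval_sub, Polynomial.eval_X, Polynomial.eval_C]
  rw [e, e', descPochhammer_eval_eq_descFactorial, Nat.descFactorial_self]
  have h := Nat.factorial_mul_descFactorial (show i ≤ N - 1 by omega)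
  have n2 := ascPochhammer_eval_ne_zero_of_pos hq n
  have n4 : ((N - 1).descFactorial i : ℝ) ≠ 0 := by
    have : (N - 1).descFactorial i ≠ 0 := by
      rw [Ne, Nat.descFactorial_eq_zero_iff_lt]; omega
    exact_mod_cast this
  rw [← h]
  push_cast
  field_simp

/-! ### Hermite polynomials and the inverse of L. -/

open Polynomial in
theorem hermitePoly_succ (n : ℕ) :
    hermitePoly (n + 1) = 2 * X * hermitePoly n - derivative (hermitePoly n) := rfl

open Polynomial in
theorem derivative_hermitePoly_succ (n : ℕ) :
    derivative (hermitePoly (n + 1)) = 2 * ((n : ℂ[X]) + 1) * hermitePoly n := by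
  induction n with
  | zero => simp [hermitePoly]
  | succ n ih =>
    rw [hermitePoly_succ (n + 1), derivative_sub, ih]
    simp only [derivative_mul, derivative_X, derivative_ofNat, derivative_add, derivative_natCast,
      derivative_one, ih]
    rw [hermitePoly_succ n]
    push_cast
    ring

/-- Hermite's differential equation. -/
theorem hermitePoly_ode (n : ℕ) :
    Polynomial.derivative (Polynomial.derivative (hermitePoly n)) =
      2 * Polynomial.X * Polynomial.derivative (hermitePoly n) - 2 * (n : Polynomial ℂ) * hermitePoly n := by
  have h := derivative_hermitePoly_succ n
  rw [hermitePoly_succ n] at h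
  simp only [Polynomial.derivative_sub, Polynomial.derivative_mul, Polynomial.derivative_X,
    Polynomial.derivative_ofNat] at h
  linear_combination -h

theorem natDegree_hermitePoly_le (n : ℕ) : (hermitePoly n).natDegree ≤ n := by
  induction n with
  | zero => simp [hermitePoly]
  | succ n ih =>
    rw [hermitePoly_succ]
    refine (Polynomial.natDegree_sub_le _ _).trans (max_le ?_ ?_)
    · refine Polynomial.natDegree_mul_le.trans ?_
      have : (2 * Polynomial.X : Polynomial ℂ).natDegree ≤ 1 := by
        rw [show (2 : Polynomial ℂ) = Polynomial.C 2 from rfl]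
        exact (Polynomial.natDegree_C_mul_le _ _).trans Polynomial.natDegree_X_le
      omega
    · refine (Polynomial.natDegree_derivative_le _).trans (by omega)

theorem coeff_hermitePoly_self (n : ℕ) : (hermitePoly n).coeff n = 2 ^ n := by
  induction n with
  | zero => simp [hermitePoly]
  | succ n ih =>
    rw [hermitePoly_succ, Polynomial.coeff_sub, mul_assoc, Polynomial.coeff_ofNat_mul,
      Polynomial.coeff_X_mul, ih, Polynomial.coeff_derivative,
      Polynomial.coeff_eq_zero_of_natDegree_lt (n := n + 1 + 1)
        (by have := natDegree_hermitePoly_le n; omega)]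
    ring

/-- The polynomials `i^k H_k(ix) / k!`, with generating function `exp (-2xt + t²)`. -/
def invHermite (k : ℕ) : Polynomial ℂ :=
  Polynomial.C (Complex.I ^ k / (k.factorial : ℂ)) *
    (hermitePoly k).comp (Polynomial.C Complex.I * Polynomial.X)

theorem C_I_mul_C_I :
    (Polynomial.C Complex.I : Polynomial ℂ) * Polynomial.C Complex.I = -1 := by
  rw [← Polynomial.C_mul, Complex.I_mul_I]; simp

theorem invHermite_zero : invHermite 0 = 1 := by simp [invHermite, hermitePoly]

theorem C_factorial_succ (k : ℕ) :
    (Polynomial.C (Complex.I ^ k / (k.factorial : ℂ)) : Polynomial ℂ) * Polynomial.C Complex.I =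
      ((k : Polynomial ℂ) + 1) *
        Polynomial.C (Complex.I ^ (k + 1) / ((k + 1).factorial : ℂ)) := by
  rw [← Polynomial.C_mul, ← Polynomial.C_eq_natCast, ← Polynomial.C_1, ← Polynomial.C_add,
    ← Polynomial.C_mul]
  congr 1
  rw [Nat.factorial_succ]
  have := Nat.factorial_ne_zero k
  push_cast
  have h : (k : ℂ) + 1 ≠ 0 := by exact_mod_cast Nat.succ_ne_zero k
  field_simp
  exact (pow_succ _ _).symm

theorem derivative_invHermite_succ (k : ℕ) :
    Polynomial.derivative (invHermite (k + 1)) = -2 * invHermite k := by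
  have h1 := C_factorial_succ k
  have h2 := C_I_mul_C_I
  rw [invHermite, invHermite, Polynomial.derivative_C_mul, Polynomial.derivative_comp,
    derivative_hermitePoly_succ, Polynomial.derivative_C_mul, Polynomial.derivative_X]
  simp only [Polynomial.mul_comp, Polynomial.add_comp, Polynomial.natCast_comp,
    Polynomial.one_comp, Polynomial.ofNat_comp]
  set A := Polynomial.C (Complex.I ^ k / (k.factorial : ℂ))
  set B := Polynomial.C (Complex.I ^ (k + 1) / ((k + 1).factorial : ℂ))
  set J := (Polynomial.C Complex.I : Polynomial ℂ)
  set Y := (hermitePoly k).comp (J * Polynomial.X)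
  linear_combination (-2 * J * Y) * h1 + (2 * A * Y) * h2

theorem invHermite_succ (k : ℕ) :
    ((k : Polynomial ℂ) + 1) * invHermite (k + 1) =
      -2 * Polynomial.X * invHermite k - Polynomial.derivative (invHermite k) := by
  have h1 := C_factorial_succ k
  have h2 := C_I_mul_C_I
  rw [invHermite, invHermite, hermitePoly_succ, Polynomial.derivative_C_mul,
    Polynomial.derivative_comp, Polynomial.derivative_C_mul, Polynomial.derivative_X]
  simp only [Polynomial.mul_comp, Polynomial.sub_comp, Polynomial.X_comp, Polynomial.ofNat_comp]
  set A := Polynomial.C (Complex.I ^ k / (k.factorial : ℂ))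
  set B := Polynomial.C (Complex.I ^ (k + 1) / ((k + 1).factorial : ℂ))
  set J := (Polynomial.C Complex.I : Polynomial ℂ)
  set Y := (hermitePoly k).comp (J * Polynomial.X)
  set Z := (Polynomial.derivative (hermitePoly k)).comp (J * Polynomial.X)
  linear_combination (-(2 * (J * Polynomial.X) * Y - Z)) * h1 +
    2 * A * Y * Polynomial.X * h2

theorem natDegree_invHermite_le (k : ℕ) : (invHermite k).natDegree ≤ k := by
  refine (Polynomial.natDegree_C_mul_le _ _).trans (Polynomial.natDegree_comp_le.trans ?_)
  refine (Nat.mul_le_mul (natDegree_hermitePoly_le k)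
    ((Polynomial.natDegree_C_mul_le _ _).trans Polynomial.natDegree_X_le)).trans (mul_one k).le

theorem coeff_invHermite_self (k : ℕ) :
    (invHermite k).coeff k = (-2) ^ k / (k.factorial : ℂ) := by
  rw [invHermite, Polynomial.coeff_C_mul, Polynomial.comp_C_mul_X_coeff, coeff_hermitePoly_self]
  rw [show (-2 : ℂ) = Complex.I * Complex.I * 2 by rw [Complex.I_mul_I]; ring, mul_pow, mul_pow]
  ring

/-- The entries `H_{a-b} / (a-b)!` of the lower triangular matrix `L`, as polynomials. -/
def lowerEntry (a b : ℕ) : Polynomial ℂ :=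
  if b ≤ a then Polynomial.C (1 / ((a - b).factorial : ℂ)) * hermitePoly (a - b) else 0

/-- The entries of the inverse of `L`, as polynomials. -/
def invEntry (a b : ℕ) : Polynomial ℂ := if b ≤ a then invHermite (a - b) else 0

/-- Together with `sub_mul_invEntry`: differentiating exp(-2xt + t²) in x, respectively applying t
d/dt, read off on coefficients. Multiplication by t becomes the column shift b ↦ b + 1. -/
theorem derivative_invEntry (a b : ℕ) :
    Polynomial.derivative (invEntry a b) = -2 * invEntry a (b + 1) := by
  unfold invEntry
  rcases lt_trichotomy b a with h | h | h
  · rw [if_pos h.le, if_pos (Nat.succ_le_of_lt h), show a - b = (a - (b + 1)) + 1 by omega,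
      derivative_invHermite_succ]
  · subst h
    simp [invHermite_zero]
  · rw [if_neg (by omega), if_neg (by omega)]; simp

theorem sub_mul_invEntry (a b : ℕ) :
    ((a : Polynomial ℂ) - (b : Polynomial ℂ)) * invEntry a b =
      -2 * Polynomial.X * invEntry a (b + 1) - Polynomial.derivative (invEntry a (b + 1)) := by
  unfold invEntry
  rcases lt_trichotomy b a with h | h | h
  · obtain ⟨k, rfl⟩ := Nat.exists_eq_add_of_lt h
    rw [if_pos h.le, if_pos (Nat.succ_le_of_lt h), show b + k + 1 - b = k + 1 by omega,
      show b + k + 1 - (b + 1) = k by omega, ← invHermite_succ]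
    push_cast; ring
  · subst h
    simp
  · rw [if_neg (by omega), if_neg (by omega)]; simp

/-- Coefficient form of exp(-2xt + t²) exp(2xt - t²) = 1. In the recursions of the two factors the
terms with 2x cancel, so the coefficients s_m of the product satisfy (m+1) s_{m+1} = -s_m'; starting
from s_0 = 1, all later ones vanish. -/
theorem sum_antidiagonal_invHermite (m : ℕ) :
    ∑ p ∈ Finset.HasAntidiagonal.antidiagonal m, invHermite p.1 *
      (Polynomial.C (1 / (p.2.factorial : ℂ)) * hermitePoly p.2) = if m = 0 then 1 else 0 := by
  have hs : ∀ k : ℕ, ((k : Polynomial ℂ) + 1) *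
      (Polynomial.C (1 / ((k + 1).factorial : ℂ)) * hermitePoly (k + 1)) =
      2 * Polynomial.X * (Polynomial.C (1 / (k.factorial : ℂ)) * hermitePoly k) -
        Polynomial.derivative (Polynomial.C (1 / (k.factorial : ℂ)) * hermitePoly k) := by
    intro k
    have : ((k : Polynomial ℂ) + 1) * Polynomial.C (1 / ((k + 1).factorial : ℂ)) =
        Polynomial.C (1 / (k.factorial : ℂ)) := by
      rw [← Polynomial.C_eq_natCast, ← Polynomial.C_1, ← Polynomial.C_add, ← Polynomial.C_mul]
      congr 1
      rw [Nat.factorial_succ]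
      have := Nat.factorial_ne_zero k
      push_cast
      have h : (k : ℂ) + 1 ≠ 0 := by exact_mod_cast Nat.succ_ne_zero k
      field_simp
    rw [← mul_assoc, this, hermitePoly_succ, Polynomial.derivative_C_mul]
    ring
  set h : ℕ → Polynomial ℂ := fun k => Polynomial.C (1 / (k.factorial : ℂ)) * hermitePoly k
    with hh
  have step : ∀ m : ℕ, ((m : Polynomial ℂ) + 1) *
      ∑ p ∈ Finset.HasAntidiagonal.antidiagonal (m + 1), invHermite p.1 * h p.2 =
      -Polynomial.derivative (∑ p ∈ Finset.HasAntidiagonal.antidiagonal m, invHermite p.1 * h p.2) := by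
    intro m
    have e : ((m : Polynomial ℂ) + 1) *
        ∑ p ∈ Finset.HasAntidiagonal.antidiagonal (m + 1), invHermite p.1 * h p.2 =
        ∑ p ∈ Finset.HasAntidiagonal.antidiagonal (m + 1), (p.1 : Polynomial ℂ) * invHermite p.1 * h p.2 +
          ∑ p ∈ Finset.HasAntidiagonal.antidiagonal (m + 1), invHermite p.1 * ((p.2 : Polynomial ℂ) * h p.2) := by
      rw [← Finset.sum_add_distrib, Finset.mul_sum]
      refine Finset.sum_congr rfl fun p hp => ?_
      have : ((m + 1 : ℕ) : Polynomial ℂ) = ((p.1 + p.2 : ℕ) : Polynomial ℂ) := by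
        rw [Finset.HasAntidiagonal.mem_antidiagonal.1 hp]
      push_cast at this
      rw [this]; ring
    rw [e, Finset.Nat.sum_antidiagonal_succ, Finset.Nat.sum_antidiagonal_succ',
      Polynomial.derivative_sum, ← Finset.sum_neg_distrib]
    simp only [Nat.cast_zero, zero_mul, mul_zero, zero_add, Nat.cast_add, Nat.cast_one]
    rw [← Finset.sum_add_distrib]
    refine Finset.sum_congr rfl fun p _ => ?_
    have h1 := hs p.2
    have h2 := invHermite_succ p.1
    rw [Polynomial.derivative_mul]
    simp only [hh] at h1 ⊢
    linear_combination (Polynomial.C (1 / (p.2.factorial : ℂ)) * hermitePoly p.2) * h2 +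
      invHermite p.1 * h1
  induction m with
  | zero => simp [invHermite_zero, hermitePoly]
  | succ m ih =>
    have := step m
    rw [ih] at this
    have h0 : Polynomial.derivative (if m = 0 then (1 : Polynomial ℂ) else 0) = 0 := by
      split_ifs <;> simp
    rw [h0, neg_zero] at this
    rw [if_neg (Nat.succ_ne_zero m)]
    refine (mul_eq_zero.1 this).resolve_left ?_
    exact_mod_cast Nat.succ_ne_zero m

theorem sum_invEntry_mul_lowerEntry {N : ℕ} {a : ℕ} (ha : a < N) (b : ℕ) :
    ∑ s ∈ Finset.range N, invEntry a s * lowerEntry s b = if a = b then 1 else 0 := by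
  rcases lt_or_ge a b with h | h
  · rw [if_neg (by omega)]
    refine Finset.sum_eq_zero fun s _ => ?_
    unfold invEntry lowerEntry
    split_ifs
    · omega
    all_goals simp
  · obtain ⟨m, rfl⟩ := Nat.exists_eq_add_of_le h
    have h1 := sum_antidiagonal_invHermite m
    rw [← Finset.Nat.sum_antidiagonal_swap, Finset.Nat.sum_antidiagonal_eq_sum_range_succ_mk] at h1
    have hs : ∑ s ∈ Finset.range N, invEntry (b + m) s * lowerEntry s b =
        ∑ s ∈ Finset.Ico b (b + (m + 1)), invEntry (b + m) s * lowerEntry s b := by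
      symm
      refine Finset.sum_subset (fun s hs => ?_) fun s _ hs => ?_
      · simp only [Finset.mem_Ico, Finset.mem_range] at hs ⊢; omega
      · simp only [Finset.mem_Ico, not_and_or, not_le, not_lt] at hs
        unfold invEntry lowerEntry
        rcases hs with hs | hs
        · rw [if_neg (by omega : ¬ b ≤ s)]; simp
        · rw [if_neg (by omega : ¬ s ≤ b + m)]; simp
    rw [hs, Finset.sum_Ico_eq_sum_range, Nat.add_sub_cancel_left]
    rw [show (if b + m = b then (1 : Polynomial ℂ) else 0) = if m = 0 then 1 else 0 by simp, ← h1]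
    refine Finset.sum_congr rfl fun s hs => ?_
    have hs : s ≤ m := Nat.lt_succ_iff.1 (Finset.mem_range.1 hs)
    unfold invEntry lowerEntry
    rw [if_pos (by omega), if_pos (by omega), show b + m - (b + s) = m - s by omega,
      Nat.add_sub_cancel_left]
    rfl

/-! ### Degrees and leading coefficients of the entries of P_n. -/

/-- The `b`-th entry of the row vector `(c_a H_{K-a})_a L⁻¹`. -/
def rowPoly (N K : ℕ) (c : ℕ → ℂ) (b : ℕ) : Polynomial ℂ :=
  ∑ a ∈ Finset.range N, Polynomial.C (c a) * (hermitePoly (K - a) * invEntry a b)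

-- Split the eigenvalue K - a of H_{K-a} as (K - b) - (a - b); the part a - b is absorbed by
-- `sub_mul_invEntry`, which produces the coupling to column b + 1. The hypothesis on c removes the
-- terms with K < a, where K - a is truncated.
open Polynomial in
theorem rowPoly_ode (N : ℕ) {K : ℕ} {c : ℕ → ℂ} (hc : ∀ a, a < N → K < a → c a = 0) (b : ℕ) :
    derivative (derivative (rowPoly N K c b)) =
      2 * X * derivative (rowPoly N K c b) - 2 * ((K : ℂ[X]) - (b : ℂ[X])) * rowPoly N K c b -
        4 * derivative (rowPoly N K c (b + 1)) := by
  simp only [rowPoly, derivative_sum, Finset.mul_sum]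
  rw [← Finset.sum_sub_distrib, ← Finset.sum_sub_distrib]
  refine Finset.sum_congr rfl fun a ha => ?_
  rcases lt_or_ge K a with h | h
  · simp [hc a (Finset.mem_range.1 ha) h]
  · have h1 := hermitePoly_ode (K - a)
    have h2 := derivative_invEntry a b
    have h3 := sub_mul_invEntry a b
    rw [Nat.cast_sub h] at h1
    simp only [derivative_mul, derivative_add, derivative_C, zero_mul, zero_add, h1, h2,
      derivative_neg, derivative_ofNat, neg_zero]
    linear_combination (2 * C (c a) * hermitePoly (K - a)) * h3

theorem natDegree_invEntry_le (a b : ℕ) : (invEntry a b).natDegree ≤ a - b := by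
  unfold invEntry
  split_ifs
  · exact natDegree_invHermite_le _
  · simp

theorem coeff_rowPoly (N : ℕ) {K : ℕ} {c : ℕ → ℂ} (hc : ∀ a, a < N → K < a → c a = 0) {b : ℕ}
    (hb : b ≤ K) :
    (rowPoly N K c b).coeff (K - b) =
      2 ^ (K - b) * ∑ l ∈ Finset.range (N - b), (-1) ^ l / (l.factorial : ℂ) * c (b + l) := by
  rw [rowPoly, Polynomial.finsetSum_coeff, Finset.mul_sum]
  have hs : ∑ a ∈ Finset.range N,
      (Polynomial.C (c a) * (hermitePoly (K - a) * invEntry a b)).coeff (K - b) =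
      ∑ a ∈ Finset.Ico b N,
        (Polynomial.C (c a) * (hermitePoly (K - a) * invEntry a b)).coeff (K - b) := by
    symm
    refine Finset.sum_subset (fun a ha => ?_) fun a ha hab => ?_
    · simp only [Finset.mem_Ico, Finset.mem_range] at ha ⊢; omega
    · simp only [Finset.mem_Ico, Finset.mem_range] at ha hab
      rw [invEntry, if_neg (by omega)]; simp
  rw [hs, Finset.sum_Ico_eq_sum_range]
  refine Finset.sum_congr rfl fun l hl => ?_
  have hl : b + l < N := by have := Finset.mem_range.1 hl; omega
  rcases lt_or_ge K (b + l) with h | h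
  · simp [hc _ hl h]
  · obtain ⟨u, rfl⟩ := Nat.exists_eq_add_of_le h
    rw [Polynomial.coeff_C_mul, show b + l + u - (b + l) = u by omega,
      show b + l + u - b = u + l by omega,
      Polynomial.coeff_mul_add_eq_of_natDegree_le (natDegree_hermitePoly_le _)
        ((natDegree_invEntry_le _ _).trans (by omega)), invEntry, if_pos (by omega),
      Nat.add_sub_cancel_left, coeff_hermitePoly_self, coeff_invHermite_self, pow_add,
      show (-2 : ℂ) = -1 * 2 by ring, mul_pow]
    ring

theorem natDegree_rowPoly_le {N n i : ℕ} {c : ℕ → ℂ}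
    (hc : ∀ a, a < N → n + i < a → c a = 0)
    (h : ∀ b < i, ∑ l ∈ Finset.range (N - b), (-1) ^ l / (l.factorial : ℂ) * c (b + l) = 0) :
    ∀ b, (rowPoly N (n + i) c b).natDegree ≤ n ∧
      (b ≠ i → (rowPoly N (n + i) c b).coeff n = 0) := by
  -- Descending induction on the column: columns with b ≥ N are zero.
  suffices H : ∀ d b, N ≤ b + d → (rowPoly N (n + i) c b).natDegree ≤ n ∧
      (b ≠ i → (rowPoly N (n + i) c b).coeff n = 0) from fun b => H N b (by omega)
  intro d
  induction d with
  | zero =>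
    intro b hb
    have : rowPoly N (n + i) c b = 0 := by
      refine Finset.sum_eq_zero fun a ha => ?_
      have := Finset.mem_range.1 ha
      rw [invEntry, if_neg (by omega)]; simp
    simp [this]
  | succ d ih =>
    intro b hb
    have key : ∀ m, n ≤ m → (rowPoly N (n + i) c b).natDegree ≤ m → ¬ (m = n ∧ b = i) →
        (rowPoly N (n + i) c b).coeff m = 0 := by
      intro m hm hdeg hne
      -- For m ≥ n the coupling term has no coefficient in degree m, so the differential equation
      -- gives (m - (n + i) + b)·coeff = 0. Only m = n + i - b escapes; it forces b < i, where the
      -- alternating sum vanishes.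
      by_cases hmb : m + b = n + i
      · have hbi : b < i := by omega
        have := coeff_rowPoly N hc (show b ≤ n + i by omega)
        rwa [h b hbi, mul_zero, show n + i - b = m by omega] at this
      · have e := congrArg (fun p => p.coeff m) (rowPoly_ode N hc b)
        have e1 := (ih (b + 1) (by omega)).1
        have z1 : (rowPoly N (n + i) c (b + 1)).coeff (m + 1) = 0 :=
          Polynomial.coeff_eq_zero_of_natDegree_lt (by omega)
        have z2 : (rowPoly N (n + i) c b).coeff (m + 1 + 1) = 0 :=
          Polynomial.coeff_eq_zero_of_natDegree_lt (by omega)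
        have z3 : (Polynomial.X * Polynomial.derivative (rowPoly N (n + i) c b)).coeff m =
            m * (rowPoly N (n + i) c b).coeff m := by
          cases m with
          | zero => simp
          | succ m =>
            rw [Polynomial.coeff_X_mul, Polynomial.coeff_derivative]
            push_cast; ring
        have z4 : (2 * (((n + i : ℕ) : Polynomial ℂ) - (b : Polynomial ℂ)) *
            rowPoly N (n + i) c b).coeff m =
            2 * (((n + i : ℕ) : ℂ) - b) * (rowPoly N (n + i) c b).coeff m := by
          rw [← Polynomial.C_eq_natCast, ← Polynomial.C_eq_natCast, ← Polynomial.C_sub, mul_assoc,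
            Polynomial.coeff_ofNat_mul, Polynomial.coeff_C_mul]
          ring
        simp only [Polynomial.coeff_sub] at e
        rw [z4, mul_assoc 2 Polynomial.X, Polynomial.coeff_ofNat_mul, z3,
          Polynomial.coeff_ofNat_mul] at e
        simp only [Polynomial.coeff_derivative] at e
        rw [z1, z2] at e
        have hz : ((m : ℂ) - (n + i) + b) * (rowPoly N (n + i) c b).coeff m = 0 := by
          push_cast at e
          linear_combination -e / 2
        refine (mul_eq_zero.1 hz).resolve_left fun h0 => hmb ?_
        have : (m : ℂ) + b = n + i := by linear_combination h0
        exact_mod_cast this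
    have hdeg : (rowPoly N (n + i) c b).natDegree ≤ n := by
      by_contra hlt
      push Not at hlt
      have := key _ hlt.le le_rfl (by omega)
      rw [Polynomial.coeff_natDegree, Polynomial.leadingCoeff_eq_zero] at this
      rw [this] at hlt
      simp at hlt
    exact ⟨hdeg, fun hb => key n le_rfl hdeg (by tauto)⟩

/-! ### The explicit coefficients and their normalization. -/

/-- The coefficient of `H_{n+i-a}` in the `(i, a)` entry of `P_n L`. -/
def mvCoeff (N : ℕ) (q : ℝ) (n i a : ℕ) : ℝ :=
  1 / 2 ^ n * (1 / (i.factorial : ℝ)) *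
    ((ascPochhammer ℝ n).eval (1 + q) / (ascPochhammer ℝ n).eval ((N : ℝ) - i + q)) *
    (((N - 1).factorial : ℝ) / ((N - 1 - a).factorial : ℝ)) * hahn N q n i a

theorem mvCoeff_eq_zero {N : ℕ} {q : ℝ} (hq : 0 < q) {n i a : ℕ} (hi : i < N) (ha : a < N)
    (h : n + i < a) : mvCoeff N q n i a = 0 := by
  rw [mvCoeff, hahn_eq_zero hq hi ha h, mul_zero]

/-- The factor (N-1)!/(N-1-a)! turns 1/l! into a binomial coefficient, so the sum is an iterated
difference of the Hahn function. The other factors are chosen to cancel `hahnCoeff_last` at b = i,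
leaving the 1/2^n that makes P_n monic. -/
theorem sum_mvCoeff {N : ℕ} {q : ℝ} (hq : 0 < q) (n : ℕ) {i b : ℕ} (hi : i < N) (hb : b ≤ i) :
    ∑ l ∈ Finset.range (N - b), (-1) ^ l / (l.factorial : ℝ) * mvCoeff N q n i (b + l) =
      if b = i then 1 / 2 ^ n else 0 := by
  have h := sum_neg_one_pow_choose_mul_hahn q n hi hb
  have n1 : ((N - 1 - b).factorial : ℝ) ≠ 0 := by exact_mod_cast Nat.factorial_ne_zero _
  have e : ∀ l ∈ Finset.range (N - b),
      (-1) ^ l / (l.factorial : ℝ) * mvCoeff N q n i (b + l) =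
      1 / 2 ^ n * (1 / (i.factorial : ℝ)) *
        ((ascPochhammer ℝ n).eval (1 + q) / (ascPochhammer ℝ n).eval ((N : ℝ) - i + q)) *
        (((N - 1).factorial : ℝ) / ((N - 1 - b).factorial : ℝ)) *
        ((-1 : ℝ) ^ l * (N - 1 - b).choose l * hahn N q n i (b + l)) := by
    intro l hl
    have hl : l ≤ N - 1 - b := by have := Finset.mem_range.1 hl; omega
    rw [Nat.cast_choose ℝ hl, mvCoeff, show N - 1 - (b + l) = N - 1 - b - l by omega]
    have n2 : ((N - 1 - b - l).factorial : ℝ) ≠ 0 := by exact_mod_cast Nat.factorial_ne_zero _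
    field_simp
  rw [Finset.sum_congr rfl e, ← Finset.mul_sum, h]
  split_ifs with hbi
  · subst hbi
    have hl := hahnCoeff_last hq n hi
    have n3 : (b.factorial : ℝ) ≠ 0 := by exact_mod_cast Nat.factorial_ne_zero _
    have n4 : (ascPochhammer ℝ n).eval ((N : ℝ) - b + q) ≠ 0 := by
      refine (ascPochhammer_pos n _ ?_).ne'
      have : (b : ℝ) < N := by exact_mod_cast hi
      linarith
    field_simp
    linear_combination hl
  · ring

/-- The entries of the monic orthogonal polynomials for `α = 1`. -/
def mvEntry (N : ℕ) (q : ℝ) (n i b : ℕ) : Polynomial ℂ :=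
  rowPoly N (n + i) (fun a => (mvCoeff N q n i a : ℂ)) b

theorem mvEntry_natDegree_le_and_coeff {N : ℕ} {q : ℝ} (hq : 0 < q) (n : ℕ) {i : ℕ} (hi : i < N)
    (b : ℕ) : (mvEntry N q n i b).natDegree ≤ n ∧
      (mvEntry N q n i b).coeff n = if i = b then 1 else 0 := by
  have hc : ∀ a, a < N → n + i < a → (mvCoeff N q n i a : ℂ) = 0 := fun a ha h => by
    rw [mvCoeff_eq_zero hq hi ha h, Complex.ofReal_zero]
  have hs : ∀ b ≤ i, ∑ l ∈ Finset.range (N - b),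
      (-1) ^ l / (l.factorial : ℂ) * (mvCoeff N q n i (b + l) : ℂ) =
      if b = i then 1 / 2 ^ n else 0 := fun b hb => by
    have := congrArg (fun x : ℝ => (x : ℂ)) (sum_mvCoeff hq n hi hb)
    push_cast at this
    rw [this]
    split_ifs <;> simp
  have h := natDegree_rowPoly_le hc (fun b hb => by rw [hs b hb.le, if_neg hb.ne]) b
  refine ⟨h.1, ?_⟩
  split_ifs with hb
  · subst hb
    have := coeff_rowPoly N hc (show i ≤ n + i by omega)
    rw [hs i le_rfl, if_pos rfl, Nat.add_sub_cancel] at this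
    rw [mvEntry, this]
    simp
  · exact h.2 (Ne.symm hb)

/-- `P_n L` has the entries `c_a H_{n+i-a}`. -/
theorem sum_rowPoly_mul_lowerEntry {N K : ℕ} (c : ℕ → ℂ) {b : ℕ} (hb : b < N) :
    ∑ s ∈ Finset.range N, rowPoly N K c s * lowerEntry s b =
      Polynomial.C (c b) * hermitePoly (K - b) := by
  simp only [rowPoly, Finset.sum_mul]
  rw [Finset.sum_comm]
  calc _ = ∑ a ∈ Finset.range N, Polynomial.C (c a) * hermitePoly (K - a) *
        ∑ s ∈ Finset.range N, invEntry a s * lowerEntry s b := by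
        refine Finset.sum_congr rfl fun a _ => ?_
        rw [Finset.mul_sum]
        refine Finset.sum_congr rfl fun s _ => by ring
    _ = ∑ a ∈ Finset.range N, if b = a then Polynomial.C (c b) * hermitePoly (K - b) else 0 := by
        refine Finset.sum_congr rfl fun a ha => ?_
        rw [sum_invEntry_mul_lowerEntry (Finset.mem_range.1 ha)]
        by_cases h : b = a
        · subst h; simp
        · rw [if_neg h, if_neg (Ne.symm h), mul_zero]
    _ = _ := by rw [Finset.sum_ite_eq, if_pos (Finset.mem_range.2 hb)]

/-! ### The Gaussian functional and Hermite orthogonality. -/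

theorem integrable_gauss_mul_eval (p : Polynomial ℂ) :
    MeasureTheory.Integrable fun x : ℝ => (Real.exp (-x ^ 2) : ℂ) * p.eval (x : ℂ) := by
  induction p using Polynomial.induction_on' with
  | add p r hp hr =>
    simp only [Polynomial.eval_add, mul_add]
    exact hp.add hr
  | monomial n a =>
    have h := integrable_rpow_mul_exp_neg_mul_sq (b := 1) one_pos (s := n)
      (by have : (0 : ℝ) ≤ n := Nat.cast_nonneg n
          linarith)
    refine (h.ofReal (𝕜 := ℂ)).const_mul a |>.congr (Filter.Eventually.of_forall fun x => ?_)
    simp only [Real.rpow_natCast, Polynomial.eval_monomial]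
    simp
    ring

/-- The Gaussian functional `p ↦ ∫ exp(-x²) p(x) dx`. -/
def gaussInt : Polynomial ℂ →ₗ[ℂ] ℂ where
  toFun p := ∫ x : ℝ, (Real.exp (-x ^ 2) : ℂ) * p.eval (x : ℂ)
  map_add' p r := by
    simp only [Polynomial.eval_add, mul_add]
    exact MeasureTheory.integral_add (integrable_gauss_mul_eval p) (integrable_gauss_mul_eval r)
  map_smul' a p := by
    simp only [Polynomial.eval_smul, smul_eq_mul, RingHom.id_apply]
    rw [← MeasureTheory.integral_const_mul]
    congr 1
    ext x
    ring

theorem gaussInt_apply (p : Polynomial ℂ) :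
    gaussInt p = ∫ x : ℝ, (Real.exp (-x ^ 2) : ℂ) * p.eval (x : ℂ) := rfl

theorem gaussInt_raise (p : Polynomial ℂ) :
    gaussInt (2 * Polynomial.X * p) = gaussInt (Polynomial.derivative p) := by
  rw [← sub_eq_zero, ← map_sub, ← neg_eq_zero, ← map_neg, gaussInt_apply]
  refine MeasureTheory.integral_eq_zero_of_hasDerivAt_of_integrable
    (f := fun x : ℝ => (Real.exp (-x ^ 2) : ℂ) * p.eval (x : ℂ)) (fun x => ?_)
    (integrable_gauss_mul_eval _) (integrable_gauss_mul_eval p)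
  have h1 : HasDerivAt (fun x : ℝ => (Real.exp (-x ^ 2) : ℂ))
      ((Real.exp (-x ^ 2) * (-(2 * x)) : ℝ) : ℂ) x := by
    refine HasDerivAt.ofReal_comp ?_
    have := ((hasDerivAt_pow 2 x).neg).exp
    simpa using this
  have h2 : HasDerivAt (fun x : ℝ => p.eval (x : ℂ)) ((Polynomial.derivative p).eval (x : ℂ)) x :=
    (p.hasDerivAt (x : ℂ)).comp_ofReal
  refine (h1.mul h2).congr_deriv ?_
  simp only [Polynomial.eval_neg, Polynomial.eval_sub, Polynomial.eval_mul, Polynomial.eval_X,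
    Polynomial.eval_ofNat]
  push_cast
  ring

/-- The raising operator 2x - d/dx is adjoint to d/dx for the Gaussian; iterating this gives
orthogonality and the norms. -/
theorem gaussInt_hermitePoly_succ_mul (n : ℕ) (p : Polynomial ℂ) :
    gaussInt (hermitePoly (n + 1) * p) = gaussInt (hermitePoly n * Polynomial.derivative p) := by
  have h := gaussInt_raise (hermitePoly n * p)
  rw [Polynomial.derivative_mul, map_add] at h
  rw [hermitePoly_succ, sub_mul, map_sub, mul_assoc, h]
  ring

theorem gaussInt_one : gaussInt 1 = (Real.sqrt Real.pi : ℂ) := by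
  rw [gaussInt_apply]
  have := integral_gaussian 1
  simp only [Polynomial.eval_one, mul_one, div_one] at this ⊢
  rw [integral_complex_ofReal, ← this]
  simp

/-- Orthogonality of the Hermite polynomials. -/
theorem gaussInt_hermitePoly_mul (m n : ℕ) :
    gaussInt (hermitePoly m * hermitePoly n) =
      if m = n then (Real.sqrt Real.pi : ℂ) * 2 ^ n * (n.factorial : ℂ) else 0 := by
  induction m generalizing n with
  | zero =>
    cases n with
    | zero => simp [hermitePoly, gaussInt_one]
    | succ n =>
      rw [mul_comm, gaussInt_hermitePoly_succ_mul]
      simp [hermitePoly]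
  | succ m ih =>
    rw [gaussInt_hermitePoly_succ_mul]
    cases n with
    | zero => simp [hermitePoly]
    | succ n =>
      rw [derivative_hermitePoly_succ]
      have : hermitePoly m * (2 * ((n : Polynomial ℂ) + 1) * hermitePoly n) =
          (2 * ((n : ℂ) + 1)) • (hermitePoly m * hermitePoly n) := by
        rw [Polynomial.smul_eq_C_mul]
        simp only [Polynomial.C_mul, Polynomial.C_add, Polynomial.C_1, Polynomial.C_eq_natCast]
        rw [show (Polynomial.C 2 : Polynomial ℂ) = 2 from rfl]
        ring
      rw [this, map_smul, ih, smul_eq_mul]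
      by_cases h : m = n
      · subst h
        rw [if_pos rfl, if_pos rfl, Nat.factorial_succ]
        push_cast; ring
      · rw [if_neg h, if_neg (by omega), mul_zero]

theorem hermitePoly_map_conj (n : ℕ) : (hermitePoly n).map (starRingEnd ℂ) = hermitePoly n := by
  induction n with
  | zero => simp [hermitePoly]
  | succ n ih =>
    rw [hermitePoly_succ, Polynomial.map_sub, ← Polynomial.derivative_map, Polynomial.map_mul, ih]
    simp

theorem eval_map_conj (p : Polynomial ℂ) (x : ℝ) :
    (p.map (starRingEnd ℂ)).eval (x : ℂ) = star (p.eval (x : ℂ)) := by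
  have := Polynomial.eval_map_apply (f := starRingEnd ℂ) (p := p) (x : ℂ)
  rw [Complex.conj_ofReal] at this
  exact this

/-! ### The matrix inner product and uniqueness. -/

/-- The matrix `L^α` with polynomial entries. -/
def lowerMat (N : ℕ) (α : ℕ → ℝ) : Matrix (Fin N) (Fin N) (Polynomial ℂ) :=
  Matrix.of fun a b =>
    Polynomial.C ((α (a + 1) : ℂ) / (α (b + 1) : ℂ)) * lowerEntry a b

/-- The inverse of `L^α`. -/
def invMat (N : ℕ) (α : ℕ → ℝ) : Matrix (Fin N) (Fin N) (Polynomial ℂ) :=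
  Matrix.of fun a b =>
    Polynomial.C ((α (a + 1) : ℂ) / (α (b + 1) : ℂ)) * invEntry a b

section

variable {N : ℕ} {α : ℕ → ℝ}

theorem ofReal_alpha_ne_zero (hα : ∀ k ∈ Finset.Icc 1 N, α k ≠ 0) (i : Fin N) :
    (α ((i : ℕ) + 1) : ℂ) ≠ 0 := by
  exact_mod_cast hα _ (Finset.mem_Icc.2 ⟨by omega, i.2⟩)

theorem Lα_apply (hα : ∀ k ∈ Finset.Icc 1 N, α k ≠ 0) (x : ℂ) (a b : Fin N) :
    Lα N α x a b = (lowerMat N α a b).eval x := by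
  have hinv : (S N α)⁻¹ = Matrix.diagonal fun i : Fin N => ((α ((i : ℕ) + 1) : ℂ))⁻¹ := by
    refine Matrix.inv_eq_left_inv ?_
    rw [S, Matrix.diagonal_mul_diagonal, ← Matrix.diagonal_one]
    congr 1
    ext i
    exact inv_mul_cancel₀ (ofReal_alpha_ne_zero hα i)
  rw [Lα, hinv, Matrix.mul_diagonal, S, Matrix.diagonal_mul]
  simp only [L, lowerMat, lowerEntry, H, Matrix.of_apply, Polynomial.eval_mul, Polynomial.eval_C]
  by_cases h : b ≤ a
  · rw [if_pos h, if_pos (show (b : ℕ) ≤ a from h)]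
    simp only [Polynomial.eval_mul, Polynomial.eval_C]
    ring
  · rw [if_neg h, if_neg (show ¬ (b : ℕ) ≤ a from h)]
    simp

theorem invMat_mul_lowerMat (hα : ∀ k ∈ Finset.Icc 1 N, α k ≠ 0) :
    invMat N α * lowerMat N α = 1 := by
  ext1 a b
  rw [Matrix.mul_apply]
  have e : ∀ s : Fin N, invMat N α a s * lowerMat N α s b =
      Polynomial.C ((α (a + 1) : ℂ) / (α (b + 1) : ℂ)) * (invEntry a s * lowerEntry s b) := by
    intro s
    have h : (α ((a : ℕ) + 1) : ℂ) / (α ((b : ℕ) + 1) : ℂ) =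
        (α ((a : ℕ) + 1) : ℂ) / (α ((s : ℕ) + 1) : ℂ) *
          ((α ((s : ℕ) + 1) : ℂ) / (α ((b : ℕ) + 1) : ℂ)) := by
      have := ofReal_alpha_ne_zero hα s
      field_simp
    simp only [invMat, lowerMat, Matrix.of_apply]
    rw [h, Polynomial.C_mul]
    ring
  rw [Finset.sum_congr rfl fun s _ => e s, ← Finset.mul_sum,
    Fin.sum_univ_eq_sum_range (fun s => invEntry a s * lowerEntry s b) N,
    sum_invEntry_mul_lowerEntry a.2, Matrix.one_apply]
  by_cases h : a = b
  · subst h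
    rw [if_pos rfl, if_pos rfl, div_self (ofReal_alpha_ne_zero hα a)]
    simp
  · rw [if_neg h, if_neg (fun h' => h (Fin.ext h')), mul_zero]

theorem evalAt_apply (P : Polynomial (Matrix (Fin N) (Fin N) ℂ)) (x : ℂ) (i j : Fin N) :
    evalAt P x i j = (matPolyEquiv.symm P i j).eval x := by
  rw [evalAt, ← matPolyEquiv_symm_map_eval]
  rfl

/-- The polynomial matrix `P L^α`. -/
def lowered (α : ℕ → ℝ) (P : Polynomial (Matrix (Fin N) (Fin N) ℂ)) :
    Matrix (Fin N) (Fin N) (Polynomial ℂ) :=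
  matPolyEquiv.symm P * lowerMat N α

theorem lowered_sub (P Q : Polynomial (Matrix (Fin N) (Fin N) ℂ)) :
    lowered α (P - Q) = lowered α P - lowered α Q := by
  rw [lowered, map_sub, Matrix.sub_mul]; rfl

theorem lowered_add (P Q : Polynomial (Matrix (Fin N) (Fin N) ℂ)) :
    lowered α (P + Q) = lowered α P + lowered α Q := by
  rw [lowered, map_add, Matrix.add_mul]; rfl

theorem lowered_C_mul (A : Matrix (Fin N) (Fin N) ℂ)
    (P : Polynomial (Matrix (Fin N) (Fin N) ℂ)) :
    lowered α (Polynomial.C A * P) = A.map Polynomial.C * lowered α P := by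
  rw [lowered, map_mul, matPolyEquiv_symm_C, Matrix.mul_assoc]; rfl

theorem evalAt_mul_Lα (hα : ∀ k ∈ Finset.Icc 1 N, α k ≠ 0)
    (P : Polynomial (Matrix (Fin N) (Fin N) ℂ)) (x : ℂ) (i j : Fin N) :
    (evalAt P x * Lα N α x) i j = (lowered α P i j).eval x := by
  rw [lowered, Matrix.mul_apply, Matrix.mul_apply, Polynomial.eval_finsetSum]
  refine Finset.sum_congr rfl fun s _ => ?_
  rw [evalAt_apply, Lα_apply hα, Polynomial.eval_mul]

/-- The integrand of the `(i, j)` entry of the inner product, without the Gaussian. -/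
def innerPoly (α δ : ℕ → ℝ) (P Q : Polynomial (Matrix (Fin N) (Fin N) ℂ)) (i j : Fin N) :
    Polynomial ℂ :=
  ∑ s : Fin N, (δ ((s : ℕ) + 1) : ℂ) •
    (lowered α P i s * (lowered α Q j s).map (starRingEnd ℂ))

theorem innerW_apply (hα : ∀ k ∈ Finset.Icc 1 N, α k ≠ 0) (δ : ℕ → ℝ)
    (P Q : Polynomial (Matrix (Fin N) (Fin N) ℂ)) (i j : Fin N) :
    innerW (weight N α δ) P Q i j = gaussInt (innerPoly α δ P Q i j) := by
  rw [innerW, Matrix.of_apply, gaussInt_apply]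
  congr 1
  ext x
  have h : evalAt P (x : ℂ) * weight N α δ x * (evalAt Q (x : ℂ))ᴴ =
      (evalAt P (x : ℂ) * Lα N α x) * T N δ x * (evalAt Q (x : ℂ) * Lα N α x)ᴴ := by
    rw [weight, Matrix.conjTranspose_mul]
    simp only [Matrix.mul_assoc]
  rw [h, T, Matrix.mul_smul, Matrix.smul_mul, Matrix.smul_apply, Matrix.mul_apply, innerPoly,
    Polynomial.eval_finsetSum, smul_eq_mul]
  congr 1
  refine Finset.sum_congr rfl fun s _ => ?_
  rw [Matrix.mul_diagonal, Matrix.conjTranspose_apply, evalAt_mul_Lα hα, evalAt_mul_Lα hα,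
    Polynomial.eval_smul, Polynomial.eval_mul, eval_map_conj, smul_eq_mul]
  ring

theorem innerW_sub_right (hα : ∀ k ∈ Finset.Icc 1 N, α k ≠ 0) (δ : ℕ → ℝ)
    (P Q R : Polynomial (Matrix (Fin N) (Fin N) ℂ)) :
    innerW (weight N α δ) P (Q - R) =
      innerW (weight N α δ) P Q - innerW (weight N α δ) P R := by
  ext i j
  rw [Matrix.sub_apply, innerW_apply hα, innerW_apply hα, innerW_apply hα, ← map_sub]
  congr 1
  rw [innerPoly, innerPoly, innerPoly, ← Finset.sum_sub_distrib]
  refine Finset.sum_congr rfl fun s _ => ?_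
  rw [lowered_sub, Matrix.sub_apply, Polynomial.map_sub, mul_sub, smul_sub]

theorem innerW_add_left (hα : ∀ k ∈ Finset.Icc 1 N, α k ≠ 0) (δ : ℕ → ℝ)
    (P Q R : Polynomial (Matrix (Fin N) (Fin N) ℂ)) :
    innerW (weight N α δ) (P + Q) R =
      innerW (weight N α δ) P R + innerW (weight N α δ) Q R := by
  ext i j
  rw [Matrix.add_apply, innerW_apply hα, innerW_apply hα, innerW_apply hα, ← map_add]
  congr 1
  rw [innerPoly, innerPoly, innerPoly, ← Finset.sum_add_distrib]
  refine Finset.sum_congr rfl fun s _ => ?_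
  rw [lowered_add, Matrix.add_apply, add_mul, smul_add]

theorem innerW_C_mul_left (hα : ∀ k ∈ Finset.Icc 1 N, α k ≠ 0) (δ : ℕ → ℝ)
    (A : Matrix (Fin N) (Fin N) ℂ) (P Q : Polynomial (Matrix (Fin N) (Fin N) ℂ)) :
    innerW (weight N α δ) (Polynomial.C A * P) Q = A * innerW (weight N α δ) P Q := by
  ext i j
  rw [Matrix.mul_apply, innerW_apply hα]
  simp only [innerW_apply hα, ← smul_eq_mul (α := ℂ), ← map_smul, ← map_sum]
  congr 1
  simp only [innerPoly, Finset.smul_sum]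
  rw [Finset.sum_comm]
  refine Finset.sum_congr rfl fun s _ => ?_
  rw [lowered_C_mul, Matrix.mul_apply, Finset.sum_mul, Finset.smul_sum]
  refine Finset.sum_congr rfl fun k _ => ?_
  rw [Matrix.map_apply, smul_comm, ← Polynomial.smul_eq_C_mul, smul_mul_assoc]

/-- The inner product is positive definite. -/
theorem eq_zero_of_innerW_self (hα : ∀ k ∈ Finset.Icc 1 N, α k ≠ 0) {δ : ℕ → ℝ}
    (hδ : ∀ k ∈ Finset.Icc 1 N, 0 < δ k) {P : Polynomial (Matrix (Fin N) (Fin N) ℂ)}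
    (h : innerW (weight N α δ) P P = 0) : P = 0 := by
  have hd : ∀ s : Fin N, 0 < δ ((s : ℕ) + 1) := fun s =>
    hδ _ (Finset.mem_Icc.2 ⟨by omega, s.2⟩)
  have hU : lowered α P = 0 := by
    ext1 i t
    -- The integrand of the i-th diagonal entry: a weighted sum of squares of row i of P L^α. It is
    -- continuous, nonnegative and has integral zero, so the whole row vanishes on the real line.
    let g : ℝ → ℝ := fun x => Real.exp (-x ^ 2) *
      ∑ s : Fin N, δ ((s : ℕ) + 1) * ‖(lowered α P i s).eval (x : ℂ)‖ ^ 2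
    have hg : ∀ x : ℝ, (g x : ℂ) =
        (Real.exp (-x ^ 2) : ℂ) * (innerPoly α δ P P i i).eval (x : ℂ) := by
      intro x
      simp only [g, innerPoly, Complex.ofReal_mul, Complex.ofReal_sum, Polynomial.eval_finsetSum]
      congr 1
      refine Finset.sum_congr rfl fun s _ => ?_
      rw [Polynomial.eval_smul, Polynomial.eval_mul, eval_map_conj, Complex.star_def,
        Complex.mul_conj, Complex.normSq_eq_norm_sq, smul_eq_mul]
    have hnn : ∀ x, 0 ≤ g x := fun x =>
      mul_nonneg (Real.exp_pos _).le
        (Finset.sum_nonneg fun s _ => mul_nonneg (hd s).le (sq_nonneg _))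
    have hint : MeasureTheory.Integrable g := by
      have := (integrable_gauss_mul_eval (innerPoly α δ P P i i)).re
      refine this.congr (Filter.Eventually.of_forall fun x => ?_)
      simp only [← hg]
      exact Complex.ofReal_re _
    have h0 : ∫ x, g x = 0 := by
      have h1 := congrFun (congrFun h i) i
      rw [innerW_apply hα, gaussInt_apply] at h1
      simp only [← hg] at h1
      rw [integral_complex_ofReal] at h1
      exact Complex.ofReal_eq_zero.1 h1
    have hcont : Continuous g := by
      refine (by fun_prop : Continuous fun x : ℝ => Real.exp (-x ^ 2)).mul
        (continuous_finsetSum _ fun s _ => continuous_const.mul (Continuous.pow ?_ 2))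
      exact ((lowered α P i s).continuous.comp Complex.continuous_ofReal).norm
    have hz : g = 0 := by
      rw [MeasureTheory.integral_eq_zero_iff_of_nonneg hnn hint] at h0
      exact (Continuous.ae_eq_iff_eq MeasureTheory.volume hcont continuous_const).1 h0
    have hroot : ∀ x : ℝ, (lowered α P i t).eval (x : ℂ) = 0 := by
      intro x
      have h1 := congrFun hz x
      have h2 := (mul_eq_zero.1 h1).resolve_left (Real.exp_pos _).ne'
      have h3 := (Finset.sum_eq_zero_iff_of_nonneg
        (fun s _ => mul_nonneg (hd s).le (sq_nonneg _))).1 h2 t (Finset.mem_univ t)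
      have h4 := (mul_eq_zero.1 h3).resolve_left (hd t).ne'
      simpa using h4
    refine Polynomial.eq_zero_of_infinite_isRoot _ ?_
    refine (Set.infinite_range_of_injective Complex.ofReal_injective).mono ?_
    rintro _ ⟨x, rfl⟩
    exact hroot x
  have h1 : matPolyEquiv.symm P = lowered α P * invMat N α := by
    rw [lowered, Matrix.mul_assoc, mul_eq_one_comm.1 (invMat_mul_lowerMat hα),
      Matrix.mul_one]
  rw [hU, Matrix.zero_mul] at h1
  exact (map_eq_zero_iff _ matPolyEquiv.symm.injective).1 h1

/-- Monic P_m allow the leading coefficient of Z to be split off from the left as a matrix multiple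
of P_m, with m < n; the remainder has smaller degree. -/
theorem innerW_eq_zero_of_degree_lt (hα : ∀ k ∈ Finset.Icc 1 N, α k ≠ 0) {δ : ℕ → ℝ}
    {P : ℕ → Polynomial (Matrix (Fin N) (Fin N) ℂ)} (hP : IsMonicOPS (weight N α δ) P) {n : ℕ} :
    ∀ m ≤ n, ∀ Z : Polynomial (Matrix (Fin N) (Fin N) ℂ), Z.degree < m →
      innerW (weight N α δ) Z (P n) = 0 := by
  intro m
  induction m with
  | zero =>
    intro _ Z hZ
    have hZ0 : Z = 0 := by
      rw [← Polynomial.degree_eq_bot]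
      simpa [Nat.WithBot.lt_zero_iff] using hZ
    have := innerW_C_mul_left hα δ 0 0 (P n)
    rw [hZ0]
    simpa using this
  | succ m ih =>
    intro hm Z hZ
    have hZ' : Z.natDegree ≤ m := by
      rw [Polynomial.natDegree_le_iff_coeff_eq_zero]
      exact fun k hk => (Polynomial.degree_lt_iff_coeff_zero _ _).1 hZ k hk
    have hdec : Z = Polynomial.C (Z.coeff m) * P m + (Z - Polynomial.C (Z.coeff m) * P m) := by
      abel
    rw [hdec, innerW_add_left hα, innerW_C_mul_left hα, hP.2 m n (by omega), mul_zero, zero_add]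
    refine ih (by omega) _ ?_
    rw [Polynomial.degree_lt_iff_coeff_zero]
    intro k hk
    rw [Polynomial.coeff_sub, Polynomial.coeff_C_mul]
    rcases Nat.eq_or_lt_of_le hk with h | h
    · subst h
      have h1 := (hP.1 m).1.coeff_natDegree
      rw [(hP.1 m).2] at h1
      rw [h1, mul_one, sub_self]
    · rw [Polynomial.coeff_eq_zero_of_natDegree_lt (by omega),
        Polynomial.coeff_eq_zero_of_natDegree_lt (p := P m) (by rw [(hP.1 m).2]; exact h),
        mul_zero, sub_zero]

/-- Monic orthogonal polynomials are unique. -/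
theorem IsMonicOPS.unique (hα : ∀ k ∈ Finset.Icc 1 N, α k ≠ 0) {δ : ℕ → ℝ}
    (hδ : ∀ k ∈ Finset.Icc 1 N, 0 < δ k)
    {P Q : ℕ → Polynomial (Matrix (Fin N) (Fin N) ℂ)} (hP : IsMonicOPS (weight N α δ) P)
    (hQ : IsMonicOPS (weight N α δ) Q) : P = Q := by
  funext n
  have hdeg : (P n - Q n).degree < n := by
    rw [Polynomial.degree_lt_iff_coeff_zero]
    intro k hk
    rw [Polynomial.coeff_sub]
    rcases Nat.eq_or_lt_of_le hk with h | h
    · subst h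
      have h1 := (hP.1 n).1.coeff_natDegree
      have h2 := (hQ.1 n).1.coeff_natDegree
      rw [(hP.1 n).2] at h1
      rw [(hQ.1 n).2] at h2
      rw [h1, h2, sub_self]
    · rw [Polynomial.coeff_eq_zero_of_natDegree_lt (p := P n) (by rw [(hP.1 n).2]; exact h),
        Polynomial.coeff_eq_zero_of_natDegree_lt (p := Q n) (by rw [(hQ.1 n).2]; exact h),
        sub_zero]
  -- P_n - Q_n has degree below n, so it is orthogonal to both P_n and Q_n, hence to itself.
  refine sub_eq_zero.1 (eq_zero_of_innerW_self hα hδ ?_)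
  rw [innerW_sub_right hα, innerW_eq_zero_of_degree_lt hα hP n le_rfl _ hdeg,
    innerW_eq_zero_of_degree_lt hα hQ n le_rfl _ hdeg, sub_zero]

end

/-! ### The explicit polynomials form a monic orthogonal sequence. -/

/-- The explicit monic matrix valued orthogonal polynomials. -/
def mvPoly (N : ℕ) (q : ℝ) (α : ℕ → ℝ) (n : ℕ) : Polynomial (Matrix (Fin N) (Fin N) ℂ) :=
  matPolyEquiv (Matrix.of fun i j : Fin N =>
    Polynomial.C ((α (i + 1) : ℂ) / (α (j + 1) : ℂ)) * mvEntry N q n i j)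

section

variable {N : ℕ} {α : ℕ → ℝ} {q : ℝ}

theorem mvPoly_natDegree_le (hq : 0 < q) (n : ℕ) : (mvPoly N q α n).natDegree ≤ n := by
  rw [Polynomial.natDegree_le_iff_coeff_eq_zero]
  intro k hk
  ext i j
  rw [mvPoly, matPolyEquiv_coeff_apply, Matrix.of_apply, Polynomial.coeff_C_mul,
    Polynomial.coeff_eq_zero_of_natDegree_lt
      ((mvEntry_natDegree_le_and_coeff hq n i.2 j).1.trans_lt hk), mul_zero, Matrix.zero_apply]

theorem mvPoly_coeff (hα : ∀ k ∈ Finset.Icc 1 N, α k ≠ 0) (hq : 0 < q) (n : ℕ) :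
    (mvPoly N q α n).coeff n = 1 := by
  ext i j
  rw [mvPoly, matPolyEquiv_coeff_apply, Matrix.of_apply, Polynomial.coeff_C_mul,
    (mvEntry_natDegree_le_and_coeff hq n i.2 j).2, Matrix.one_apply]
  by_cases h : i = j
  · subst h
    rw [if_pos rfl, if_pos rfl, div_self (ofReal_alpha_ne_zero hα i), mul_one]
  · rw [if_neg h, if_neg (fun h' => h (Fin.ext h')), mul_zero]

theorem lowered_mvPoly (hα : ∀ k ∈ Finset.Icc 1 N, α k ≠ 0) (n : ℕ) (i s : Fin N) :
    lowered α (mvPoly N q α n) i s =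
      Polynomial.C (((α (i + 1) / α (s + 1) * mvCoeff N q n i s : ℝ)) : ℂ) *
        hermitePoly (n + i - s) := by
  rw [lowered, mvPoly, AlgEquiv.symm_apply_apply, Matrix.mul_apply]
  have e : ∀ u : Fin N, (Matrix.of fun i j : Fin N =>
      Polynomial.C ((α (i + 1) : ℂ) / (α (j + 1) : ℂ)) * mvEntry N q n i j) i u *
        lowerMat N α u s = Polynomial.C ((α (i + 1) : ℂ) / (α (s + 1) : ℂ)) *
          (mvEntry N q n i u * lowerEntry u s) := by
    intro u
    have h : (α ((i : ℕ) + 1) : ℂ) / (α ((s : ℕ) + 1) : ℂ) =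
        (α ((i : ℕ) + 1) : ℂ) / (α ((u : ℕ) + 1) : ℂ) *
          ((α ((u : ℕ) + 1) : ℂ) / (α ((s : ℕ) + 1) : ℂ)) := by
      have := ofReal_alpha_ne_zero hα u
      field_simp
    simp only [lowerMat, Matrix.of_apply]
    rw [h, Polynomial.C_mul]
    ring
  rw [Finset.sum_congr rfl fun u _ => e u, ← Finset.mul_sum,
    Fin.sum_univ_eq_sum_range (fun u => mvEntry N q n i u * lowerEntry u s) N]
  simp only [mvEntry]
  rw [sum_rowPoly_mul_lowerEntry _ s.2, ← mul_assoc, ← Polynomial.C_mul]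
  push_cast
  rfl

theorem innerW_mvPoly (hα : ∀ k ∈ Finset.Icc 1 N, α k ≠ 0) (hq : 0 < q) {δ : ℕ → ℝ} {D : ℝ}
    (hD : ∀ s < N, δ (s + 1) * (s.factorial * (N - 1).factorial) =
      D * α (s + 1) ^ 2 * 2 ^ s * (ascPochhammer ℝ s).eval (1 + q) * (N - 1 - s).factorial)
    {m n : ℕ} (hmn : m ≠ n) :
    innerW (weight N α δ) (mvPoly N q α m) (mvPoly N q α n) = 0 := by
  ext i j
  rw [innerW_apply hα, innerPoly, map_sum, Matrix.zero_apply]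
  have e : ∀ s : Fin N, gaussInt ((δ ((s : ℕ) + 1) : ℂ) •
      (lowered α (mvPoly N q α m) i s *
        (lowered α (mvPoly N q α n) j s).map (starRingEnd ℂ))) =
      ((δ (s + 1) * (α (i + 1) / α (s + 1) * mvCoeff N q m i s) *
        (α (j + 1) / α (s + 1) * mvCoeff N q n j s) : ℝ) : ℂ) *
        gaussInt (hermitePoly (m + i - s) * hermitePoly (n + j - s)) := by
    intro s
    rw [lowered_mvPoly hα, lowered_mvPoly hα, Polynomial.map_mul, hermitePoly_map_conj,
      Polynomial.map_C, Complex.conj_ofReal, ← smul_eq_mul (α := ℂ), ← map_smul]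
    congr 1
    rw [Polynomial.smul_eq_C_mul, Polynomial.smul_eq_C_mul]
    simp only [Complex.ofReal_mul, Polynomial.C_mul]
    ring
  rw [Finset.sum_congr rfl fun s _ => e s]
  by_cases hK : m + i = n + j
  · have hij : (i : ℕ) ≠ j := by omega
    have horth := hahn_orthogonality hq i.2 j.2 hK rfl hij
    have hs : ∀ s : Fin N, ((δ (s + 1) * (α (i + 1) / α (s + 1) * mvCoeff N q m i s) *
        (α (j + 1) / α (s + 1) * mvCoeff N q n j s) : ℝ) : ℂ) *
        gaussInt (hermitePoly (m + i - s) * hermitePoly (n + j - s)) =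
        ((Real.sqrt Real.pi * D * 2 ^ (n + (j : ℕ)) * (N - 1).factorial *
          (α (i + 1) * α (j + 1)) *
          (1 / 2 ^ m * (1 / ((i : ℕ).factorial : ℝ)) *
            ((ascPochhammer ℝ m).eval (1 + q) /
              (ascPochhammer ℝ m).eval ((N : ℝ) - (i : ℕ) + q))) *
          (1 / 2 ^ n * (1 / ((j : ℕ).factorial : ℝ)) *
            ((ascPochhammer ℝ n).eval (1 + q) /
              (ascPochhammer ℝ n).eval ((N : ℝ) - (j : ℕ) + q))) : ℝ) : ℂ) *
        ((hahnWeight N q (n + j) s * hahn N q m i s * hahn N q n j s : ℝ) : ℂ) := by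
      intro s
      rw [hK, gaussInt_hermitePoly_mul, if_pos rfl]
      -- Beyond n + j the subtraction is truncated, so the Hermite norm is not the intended one, but
      -- the Hahn factor is zero there.
      rcases lt_or_ge (n + (j : ℕ)) s with h | h
      · rw [mvCoeff_eq_zero hq j.2 s.2 h, hahn_eq_zero hq j.2 s.2 h]
        simp
      · obtain ⟨u, hu⟩ := Nat.exists_eq_add_of_le h
        have h1 := hD s s.2
        have h2 : α ((s : ℕ) + 1) ≠ 0 := hα _ (Finset.mem_Icc.2 ⟨by omega, s.2⟩)
        have h3 : ((s : ℕ).factorial : ℝ) ≠ 0 := by exact_mod_cast Nat.factorial_ne_zero _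
        have h4 : ((N - 1).factorial : ℝ) ≠ 0 := by exact_mod_cast Nat.factorial_ne_zero _
        have h5 : ((N - 1 - s).factorial : ℝ) ≠ 0 := by exact_mod_cast Nat.factorial_ne_zero _
        have h6 : δ ((s : ℕ) + 1) = D * α (s + 1) ^ 2 * 2 ^ (s : ℕ) *
            (ascPochhammer ℝ s).eval (1 + q) * (N - 1 - s).factorial /
              ((s : ℕ).factorial * (N - 1).factorial) := by
          rw [eq_div_iff (mul_ne_zero h3 h4)]; exact h1
        have h7 : (Real.sqrt Real.pi : ℂ) * 2 ^ (n + (j : ℕ) - s) *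
            ((n + (j : ℕ) - s).factorial : ℂ) =
            ((Real.sqrt Real.pi * 2 ^ (n + (j : ℕ) - s) *
              ((n + (j : ℕ) - s).factorial : ℝ) : ℝ) : ℂ) := by push_cast; rfl
        rw [h7, ← Complex.ofReal_mul, ← Complex.ofReal_mul]
        congr 1
        rw [h6, mvCoeff, mvCoeff, hahnWeight, hu, Nat.add_sub_cancel_left, pow_add]
        generalize (ascPochhammer ℝ m).eval (1 + q) /
          (ascPochhammer ℝ m).eval ((N : ℝ) - (i : ℕ) + q) = Y
        generalize (ascPochhammer ℝ n).eval (1 + q) /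
          (ascPochhammer ℝ n).eval ((N : ℝ) - (j : ℕ) + q) = Z
        field_simp
    rw [Finset.sum_congr rfl fun s _ => hs s, ← Finset.mul_sum, ← Complex.ofReal_sum,
      Fin.sum_univ_eq_sum_range
        (fun s => hahnWeight N q (n + j) s * hahn N q m i s * hahn N q n j s) N, horth]
    simp
  · refine Finset.sum_eq_zero fun s _ => ?_
    -- Either a truncated index meets a zero coefficient, or both subtractions are genuine and the
    -- two Hermite degrees differ.
    rcases lt_or_ge (m + (i : ℕ)) s with h | h
    · rw [mvCoeff_eq_zero hq i.2 s.2 h]; simp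
    · rcases lt_or_ge (n + (j : ℕ)) s with h' | h'
      · rw [mvCoeff_eq_zero hq j.2 s.2 h']; simp
      · rw [gaussInt_hermitePoly_mul, if_neg (by omega), mul_zero]

theorem isMonicOPS_mvPoly (hN : 1 ≤ N) (hα : ∀ k ∈ Finset.Icc 1 N, α k ≠ 0) (hq : 0 < q)
    {δ : ℕ → ℝ} {D : ℝ}
    (hD : ∀ s < N, δ (s + 1) * (s.factorial * (N - 1).factorial) =
      D * α (s + 1) ^ 2 * 2 ^ s * (ascPochhammer ℝ s).eval (1 + q) * (N - 1 - s).factorial) :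
    IsMonicOPS (weight N α δ) (mvPoly N q α) := by
  have : Nonempty (Fin N) := ⟨⟨0, hN⟩⟩
  refine ⟨fun n => ⟨?_, ?_⟩, fun m n hmn => innerW_mvPoly hα hq hD hmn⟩
  · exact Polynomial.monic_of_natDegree_le_of_coeff_eq_one n (mvPoly_natDegree_le hq n)
      (mvPoly_coeff hα hq n)
  · refine Polynomial.natDegree_eq_of_le_of_coeff_ne_zero (mvPoly_natDegree_le hq n) ?_
    rw [mvPoly_coeff hα hq]
    exact one_ne_zero

/-! ### Translation into the hypergeometric formula. -/

theorem poch_ofReal (x : ℝ) (k : ℕ) : poch (x : ℂ) k = ((ascPochhammer ℝ k).eval x : ℝ) := by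
  rw [poch, ← ascPochhammer_map Complex.ofRealHom, ← Complex.ofRealHom_eq_coe,
    Polynomial.eval_map_apply]
  rfl

theorem threeFTwo_eq_hahn (q : ℝ) (n i : ℕ) {a : ℕ} (ha : a < N) :
    threeFTwo (1 - ((a + 1 : ℕ) : ℂ)) (((i + 1 : ℕ) : ℂ) - N) ((n : ℂ) + 1 + (q : ℂ))
      (1 - (N : ℂ)) (1 + (q : ℂ)) 1 = (hahn N q n i a : ℂ) := by
  have e1 : 1 - ((a + 1 : ℕ) : ℂ) = ((-(a : ℝ) : ℝ) : ℂ) := by push_cast; ring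
  have e2 : ((i + 1 : ℕ) : ℂ) - N = (((i : ℝ) + 1 - N : ℝ) : ℂ) := by push_cast; ring
  have e3 : (n : ℂ) + 1 + (q : ℂ) = (((n : ℝ) + 1 + q : ℝ) : ℂ) := by push_cast; ring
  have e4 : 1 - (N : ℂ) = ((1 - (N : ℝ) : ℝ) : ℂ) := by push_cast; ring
  have e5 : 1 + (q : ℂ) = ((1 + q : ℝ) : ℂ) := by push_cast; ring
  rw [e1, e2, e3, e4, e5, threeFTwo]
  simp only [poch_ofReal, ascPochhammer_eval_neg_natCast]
  -- Since a < N, the factor (-a)_k is zero for k ≥ N, so the indices with (1-N)_k = 0 contribute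
  -- nothing.
  rw [tsum_eq_sum (s := Finset.range N)]
  · rw [hahn, Complex.ofReal_sum]
    refine Finset.sum_congr rfl fun k _ => ?_
    have h : ((a.descFactorial k : ℕ) : ℝ) = (k.factorial : ℝ) * (a.choose k : ℝ) := by
      rw [Nat.descFactorial_eq_factorial_mul_choose]; push_cast; ring
    have h0 : (k.factorial : ℂ) ≠ 0 := by exact_mod_cast Nat.factorial_ne_zero k
    rw [h, hahnCoeff]
    push_cast
    rw [one_pow, mul_one]
    generalize (((ascPochhammer ℝ k).eval (1 - (N : ℝ)) : ℝ) : ℂ) = A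
    generalize (((ascPochhammer ℝ k).eval (1 + q) : ℝ) : ℂ) = B
    rw [show ∀ x y z w : ℂ, x * (k.factorial * y) * z * w / (A * B * k.factorial) =
      (k.factorial : ℂ) * (x * y * (z * w)) / (k.factorial * (A * B)) from
        fun x y z w => by ring, mul_div_mul_left _ _ h0, mul_div_assoc]
  · intro k hk
    rw [Nat.descFactorial_of_lt (by simp at hk; omega)]
    simp

theorem poch_eq_factorial_div {a : ℕ} (ha : a < N) :
    poch ((N : ℂ) - ((a + 1 : ℕ) : ℂ) + 1) a =
      ((N - 1).factorial : ℂ) / ((N - 1 - a).factorial : ℂ) := by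
  obtain ⟨u, rfl⟩ := Nat.exists_eq_add_of_lt ha
  have e : ((a + u + 1 : ℕ) : ℂ) - ((a + 1 : ℕ) : ℂ) + 1 = ((u + 1 : ℕ) : ℂ) := by
    push_cast; ring
  have h := Nat.factorial_mul_ascFactorial u a
  rw [e, poch, ← Nat.cast_ascFactorial, show a + u + 1 - 1 = u + a by omega,
    show u + a - a = u by omega, ← h]
  have h0 : (u.factorial : ℂ) ≠ 0 := by exact_mod_cast Nat.factorial_ne_zero u
  push_cast
  field_simp

theorem evalAt_mvPoly (hq : 0 < q) (n : ℕ) (x : ℂ) (i j : Fin N) :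
    evalAt (mvPoly N q α n) x i j =
      (α (i + 1) : ℂ) / (2 ^ n * (α (j + 1) : ℂ)) * (1 / ((i : ℕ).factorial : ℂ)) *
        (((ascPochhammer ℝ n).eval (1 + q) /
          (ascPochhammer ℝ n).eval ((N : ℝ) - (i : ℕ) + q) : ℝ) : ℂ) *
        ∑ s ∈ Finset.Icc ((j : ℕ) + 1) (min N (n + (i + 1))),
          Complex.I ^ (s - (j + 1)) * poch ((N : ℂ) - s + 1) (s - 1) /
              ((s - (j + 1)).factorial : ℂ) *
            threeFTwo (1 - (s : ℂ)) (((i + 1 : ℕ) : ℂ) - N) ((n : ℂ) + 1 + (q : ℂ))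
              (1 - (N : ℂ)) (1 + (q : ℂ)) 1 *
            H (n + (i + 1) - s) x * H (s - (j + 1)) (Complex.I * x) := by
  rw [evalAt_apply, mvPoly, AlgEquiv.symm_apply_apply, Matrix.of_apply, Polynomial.eval_mul,
    Polynomial.eval_C, mvEntry, rowPoly, Polynomial.eval_finsetSum, Finset.mul_sum,
    Finset.mul_sum]
  symm
  -- Reindex by a = s - 1. The terms missing on the left have a > n + i, where the Hahn factor
  -- vanishes, or a < j, where the inverse matrix does.
  refine Finset.sum_of_injOn (fun s => s - 1) ?_ ?_ ?_ ?_
  · intro s hs t ht hst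
    simp only [Finset.coe_Icc, Set.mem_Icc] at hs ht hst
    omega
  · intro s hs
    simp only [Finset.coe_Icc, Set.mem_Icc, Finset.coe_range, Set.mem_Iio] at hs ⊢
    omega
  · intro a ha hne
    have ha := Finset.mem_range.1 ha
    rcases lt_or_ge (n + (i : ℕ)) a with h | h
    · rw [mvCoeff_eq_zero hq i.2 ha h]; simp
    · rcases lt_or_ge a j with h' | h'
      · rw [invEntry, if_neg (by omega)]; simp
      · exact absurd ⟨a + 1, by simp only [Finset.coe_Icc, Set.mem_Icc]; omega, rfl⟩ hne
  · intro s hs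
    obtain ⟨a, rfl⟩ : ∃ a, s = a + 1 := ⟨s - 1, by simp only [Finset.mem_Icc] at hs; omega⟩
    simp only [Finset.mem_Icc] at hs
    rw [threeFTwo_eq_hahn q n i (by omega : a < N), Nat.add_sub_cancel,
      poch_eq_factorial_div (by omega : a < N), invEntry, if_pos (by omega), invHermite, mvCoeff,
      show n + ((i : ℕ) + 1) - (a + 1) = n + i - a by omega,
      show a + 1 - ((j : ℕ) + 1) = a - j by omega]
    simp only [Polynomial.eval_mul, Polynomial.eval_C, Polynomial.eval_comp, Polynomial.eval_X, H]
    push_cast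
    ring

end

/-! ### Consequences of the parameter recursions. -/

/-- The compatibility of the recursions for consecutive parameters forces `c / d` to increase
by `1`. -/
theorem ratio_succ {N : ℕ} (hN : 2 ≤ N) {X c d c' d' e₁ e₂ e₁' e₂' : ℝ}
    (hc : 0 < c) (hd : 0 < d) (hc' : 0 < c') (hd' : 0 < d')
    (he₁ : 0 < e₁) (he₂ : 0 < e₂)
    (h₁ : e₁' = (d + c) * e₁) (h₂ : e₂' = (2 * d + c) * e₂)
    (hX : X = d * ((N : ℝ) - 1) / (2 * (d + c)) * (e₂ / e₁))
    (hX' : X = d' * ((N : ℝ) - 1) / (2 * (d' + c')) * (e₂' / e₁')) :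
    c' / d' = c / d + 1 := by
  have hN' : (N : ℝ) - 1 ≠ 0 := by
    have : (2 : ℝ) ≤ N := by exact_mod_cast hN
    linarith
  rw [h₁, h₂, hX] at hX'
  have h1 : d + c ≠ 0 := by positivity
  have h2 : d' + c' ≠ 0 := by positivity
  field_simp at hX' ⊢
  linear_combination hX'

theorem prod_ratio_eq {q : ℝ} (hq : 0 < q) {N i : ℕ} (hi : i < N) {f : ℕ → ℝ}
    (hf0 : f 0 = q) (hf : 2 ≤ N → ∀ k, f (k + 1) = f k + 1) (hpos : ∀ k, 0 < f k) (n : ℕ) :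
    ∏ k ∈ Finset.range n, (1 + f k) / ((N : ℝ) - (i + 1 : ℕ) + 1 + f k) =
      (ascPochhammer ℝ n).eval (1 + q) / (ascPochhammer ℝ n).eval ((N : ℝ) - i + q) := by
  -- For N = 1 nothing relates the consecutive values of f, but then every factor of the product
  -- equals 1.
  rcases Nat.lt_or_ge N 2 with h | h
  · obtain rfl : N = 1 := by omega
    obtain rfl : i = 0 := by omega
    have h0 := ascPochhammer_eval_ne_zero_of_pos hq n
    have e : ((1 : ℕ) : ℝ) - (0 : ℕ) + q = 1 + q := by push_cast; ring
    rw [e, div_self h0]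
    refine Finset.prod_eq_one fun k _ => ?_
    have := hpos k
    rw [show ((1 : ℕ) : ℝ) - (0 + 1 : ℕ) + 1 + f k = 1 + f k by push_cast; ring]
    exact div_self (by positivity)
  · have hfk : ∀ k, f k = q + k := by
      intro k
      induction k with
      | zero => simp [hf0]
      | succ k ih => rw [hf h, ih]; push_cast; ring
    induction n with
    | zero => simp
    | succ n ih =>
      rw [Finset.prod_range_succ, ih, ascPochhammer_succ_eval, ascPochhammer_succ_eval, hfk,
        div_mul_div_comm]
      push_cast
      congr 2 <;> ring

/-- The recursion for α_{k+1}²/α_k² is a two-term recursion for δ; this is its solution, with α_1 =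
1 fixing the constant as δ_1. -/
theorem weight_coefficients {N : ℕ} {α δ : ℕ → ℝ} {c d : ℝ} (hc : 0 < c) (hd : 0 < d)
    (hα : ∀ k ∈ Finset.Icc 1 N, α k ≠ 0) (hα1 : α 1 = 1) (hδ : ∀ k ∈ Finset.Icc 1 N, 0 < δ k)
    (hrec : ∀ k ∈ Finset.Ico 1 N, α (k + 1) ^ 2 / α k ^ 2 =
      d * k * ((N : ℝ) - k) / (2 * (d * k + c)) * (δ (k + 1) / δ k)) :
    ∀ s < N, δ (s + 1) * (s.factorial * (N - 1).factorial) =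
      δ 1 * α (s + 1) ^ 2 * 2 ^ s * (ascPochhammer ℝ s).eval (1 + c / d) *
        (N - 1 - s).factorial := by
  intro s
  induction s with
  | zero => intro _; simp [hα1]
  | succ s ih =>
    intro hs
    have h := ih (by omega)
    obtain ⟨u, hu⟩ := Nat.exists_eq_add_of_lt hs
    have hr := hrec (s + 1) (Finset.mem_Ico.2 ⟨by omega, hs⟩)
    have h1 := hα (s + 1) (Finset.mem_Icc.2 ⟨by omega, by omega⟩)
    have h2 := hδ (s + 1) (Finset.mem_Icc.2 ⟨by omega, by omega⟩)
    have h3 : (N : ℝ) - ((s + 1 : ℕ) : ℝ) = u + 1 := by rw [hu]; push_cast; ring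
    rw [h3] at hr
    have e1 : N - 1 - s = u + 1 := by omega
    have e2 : N - 1 - (s + 1) = u := by omega
    rw [e1, Nat.factorial_succ] at h
    rw [e2, ascPochhammer_succ_eval, Nat.factorial_succ]
    have h4 : 0 < d * ((s + 1 : ℕ) : ℝ) + c := by positivity
    have h5 : 1 + c / d + s = (d * ((s + 1 : ℕ) : ℝ) + c) / d := by
      field_simp; push_cast; ring
    rw [h5]
    have h6 : δ (s + 1 + 1) * (d * ((s + 1 : ℕ) : ℝ) * (u + 1)) * α (s + 1) ^ 2 =
        α (s + 1 + 1) ^ 2 * (2 * (d * ((s + 1 : ℕ) : ℝ) + c)) * δ (s + 1) := by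
      field_simp at hr
      linear_combination -hr
    have h7 : (d * ((u : ℝ) + 1) * α (s + 1) ^ 2) ≠ 0 := by positivity
    refine mul_left_cancel₀ h7 ?_
    generalize (ascPochhammer ℝ s).eval (1 + c / d) = A at *
    -- E is the new Pochhammer factor 1 + c/d + s.
    obtain ⟨E, hE⟩ : ∃ E, d * ((s + 1 : ℕ) : ℝ) + c = E * d :=
      ⟨_, (div_mul_cancel₀ _ hd.ne').symm⟩
    rw [hE] at h6 ⊢
    rw [mul_div_cancel_right₀ _ hd.ne']
    push_cast at h h6 ⊢
    linear_combination (s.factorial : ℝ) * ((N - 1).factorial : ℝ) * h6 +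
      2 * E * d * α (s + 1 + 1) ^ 2 * h

end MVHermite

end

/-! ### The main theorem. -/

theorem mainTheorem1
    (N : ℕ) (hN : 1 ≤ N)
    (α : ℕ → ℝ) (hα : ∀ k ∈ Finset.Icc 1 N, α k ≠ 0) (hα1 : α 1 = 1)
    (δ : ℝ → ℕ → ℝ) (c d : ℝ → ℝ) (ν : ℝ)
    (hδ : ∀ j : ℕ, ∀ k ∈ Finset.Icc 1 N, 0 < δ (ν + j) k)
    (hc : ∀ j : ℕ, 0 < c (ν + j)) (hd : ∀ j : ℕ, 0 < d (ν + j))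
    (hΔ : ∀ j : ℕ, ∀ k ∈ Finset.Icc 1 N,
      δ (ν + j + 1) k = (k * d (ν + j) + c (ν + j)) * δ (ν + j) k)
    (hrec : ∀ j : ℕ, ∀ k ∈ Finset.Ico 1 N,
      α (k + 1) ^ 2 / α k ^ 2 =
        d (ν + j) * k * ((N : ℝ) - k) / (2 * (d (ν + j) * k + c (ν + j))) *
          (δ (ν + j) (k + 1) / δ (ν + j) k)) :
    (∃! P : ℕ → Polynomial (Matrix (Fin N) (Fin N) ℂ),
      MVHermite.IsMonicOPS (MVHermite.weight N α (δ ν)) P) ∧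
    ∀ P : ℕ → Polynomial (Matrix (Fin N) (Fin N) ℂ),
      MVHermite.IsMonicOPS (MVHermite.weight N α (δ ν)) P →
      ∀ (n : ℕ) (x : ℂ) (i j : Fin N) (r t : ℕ), r = (i : ℕ) + 1 → t = (j : ℕ) + 1 →
        MVHermite.evalAt (P n) x i j =
          (α r : ℂ) / (2 ^ n * (α t : ℂ)) * (1 / ((r - 1).factorial : ℂ)) *
          (∏ k ∈ Finset.range n,
            (1 + (c (ν + k) : ℂ) / (d (ν + k) : ℂ)) /
              ((N : ℂ) - r + 1 + (c (ν + k) : ℂ) / (d (ν + k) : ℂ))) *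
          ∑ s ∈ Finset.Icc t (min N (n + r)),
            Complex.I ^ (s - t) * MVHermite.poch ((N : ℂ) - s + 1) (s - 1) /
                ((s - t).factorial : ℂ) *
              MVHermite.threeFTwo (1 - (s : ℂ)) ((r : ℂ) - N)
                ((n : ℂ) + 1 + (c ν : ℂ) / (d ν : ℂ))
                (1 - (N : ℂ)) (1 + (c ν : ℂ) / (d ν : ℂ)) 1 *
              MVHermite.H (n + r - s) x * MVHermite.H (s - t) (Complex.I * x) := by
  have hc0 : 0 < c ν := by simpa using hc 0
  have hd0 : 0 < d ν := by simpa using hd 0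
  have hδ0 : ∀ k ∈ Finset.Icc 1 N, 0 < δ ν k := fun k hk => by simpa using hδ 0 k hk
  have hrec0 : ∀ k ∈ Finset.Ico 1 N, α (k + 1) ^ 2 / α k ^ 2 =
      d ν * k * ((N : ℝ) - k) / (2 * (d ν * k + c ν)) * (δ ν (k + 1) / δ ν k) :=
    fun k hk => by simpa using hrec 0 k hk
  have hq : 0 < c ν / d ν := div_pos hc0 hd0
  have hops : MVHermite.IsMonicOPS (MVHermite.weight N α (δ ν))
      (MVHermite.mvPoly N (c ν / d ν) α) :=
    MVHermite.isMonicOPS_mvPoly hN hα hq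
      (MVHermite.weight_coefficients hc0 hd0 hα hα1 hδ0 hrec0)
  have huniq : ∀ P, MVHermite.IsMonicOPS (MVHermite.weight N α (δ ν)) P →
      P = MVHermite.mvPoly N (c ν / d ν) α :=
    fun P hP => MVHermite.IsMonicOPS.unique hα hδ0 hP hops
  refine ⟨⟨_, hops, huniq⟩, ?_⟩
  rintro P hP n x i j r t rfl rfl
  -- The left side of the α recursion does not depend on the parameter, so its case k = 1 at two
  -- consecutive parameters can be compared.
  have hratio : 2 ≤ N → ∀ k : ℕ,
      c (ν + (k + 1 : ℕ)) / d (ν + (k + 1 : ℕ)) = c (ν + k) / d (ν + k) + 1 := by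
    intro h2 k
    have m1 : 1 ∈ Finset.Icc 1 N := Finset.mem_Icc.2 ⟨le_rfl, hN⟩
    have m2 : 2 ∈ Finset.Icc 1 N := Finset.mem_Icc.2 ⟨one_le_two, h2⟩
    have m3 : 1 ∈ Finset.Ico 1 N := Finset.mem_Ico.2 ⟨le_rfl, h2⟩
    have e : ν + (k + 1 : ℕ) = ν + k + 1 := by push_cast; ring
    have a1 := hΔ k 1 m1
    have a2 := hΔ k 2 m2
    have a3 := hrec k 1 m3
    have a4 := hrec (k + 1) 1 m3
    rw [← e] at a1 a2
    simp only [Nat.cast_one, mul_one, one_mul, Nat.cast_ofNat, Nat.reduceAdd] at a1 a2 a3 a4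
    exact MVHermite.ratio_succ h2 (hc k) (hd k) (hc (k + 1)) (hd (k + 1)) (hδ k 1 m1) (hδ k 2 m2)
      a1 a2 a3 a4
  have hprod := MVHermite.prod_ratio_eq hq i.2 (f := fun k : ℕ => c (ν + k) / d (ν + k))
    (by simp) hratio (fun k => div_pos (hc k) (hd k)) n
  have hprod' : ∏ k ∈ Finset.range n, (1 + (c (ν + k) : ℂ) / (d (ν + k) : ℂ)) /
      ((N : ℂ) - ((i : ℕ) + 1 : ℕ) + 1 + (c (ν + k) : ℂ) / (d (ν + k) : ℂ)) =
      (((ascPochhammer ℝ n).eval (1 + c ν / d ν) /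
        (ascPochhammer ℝ n).eval ((N : ℝ) - (i : ℕ) + c ν / d ν) : ℝ) : ℂ) := by
    rw [← hprod]
    push_cast
    rfl
  rw [huniq P hP, MVHermite.evalAt_mvPoly hq, hprod', Nat.add_sub_cancel, Complex.ofReal_div (c ν)]
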